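/- **Conventions.** Let $G^{\mathbb C}=SL_3(\mathbb C)$, $G=SU(3)$, and write conjugation with respect to the real form as $\bar g=(g^\dagger)^{-1}$ on $G^{\mathbb C}$ and $\bar X=-X^\dagger$ on $\mathfrak g^{\mathbb C}=\mathfrak{sl}_3(\mathbb C)$. Let $\tau(g)=S(g^t)^{-1}S^{-1}$, with induced map $\tau(X)=-SX^tS^{-1}$, where $S=\begin{pmatrix}J&0\\0&1\end{pmatrix}$, $J=\begin{pmatrix}0&1\\-1&0\end{pmatrix}$. Let $G_0=\{g\in SU(3):\tau(g)=g\}$, $G_0^{\mathbb C}=\{g\in SL_3(\mathbb C):\tau(g)=g\}$, and let $B\subset G_0^{\mathbb C}$ be the subgroup of upper triangular matrices with positive real diagonal entries. The gauge group is $\mathcal G_0=C^\infty(\mathbb C,G_0)$, acting on maps by right multiplication, and $[F]$ denotes the class of $F$. For $\Delta\subset\mathbb C\cup\{\infty\}$ let $\Lambda^\tau(\Delta,G)$ be the set of analytic $g:\Delta\to G^{\mathbb C}$ with $\overline{g_\zeta}=g_{\bar\zeta^{-1}}$ and $\tau(g_\zeta)=g_{i\zeta}$, and define $\Lambda^\tau(\Delta,\mathfrak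 g)$ in the same way with values in $\mathfrak g^{\mathbb C}$. For $0<\epsilon<1$ let $C_\epsilon=\{|\zeta|=\epsilon\}\cup\{|\zeta|=\epsilon^{-1}\}$, $E_\epsilon=\{\epsilon\le|\zeta|\le\epsilon^{-1}\}$, $I_\epsilon=\{|\zeta|\le\epsilon\}\cup\{|\zeta|\ge\epsilon^{-1}\}\cup\{\infty\}$, and $\Lambda^\tau_B(I_\epsilon,G)=\{g\in\Lambda^\tau(I_\epsilon,G):g_0\in B\}$. For a loop $\xi$ on $C_\epsilon$ with the real symmetry and a scalar function $f$, $f\xi$ means multiplication by $f$ on $|\zeta|=\epsilon$, extended to $|\zeta|=\epsilon^{-1}$ by the real symmetry. Let $\Lambda^\epsilon_{-2,\infty}$ be the set of $\xi\in\Lambda^\tau(C_\epsilon,\mathfrak g)$ such that $\zeta^2\xi$ extends holomorphically to $I_\epsilon$. **Frames.** Let $\mu$ be a constant real $1$-form on $\mathbb C$. Let $\hat{\mathcal E}(\mu)$ be the set of smooth maps $F_\zeta:\mathbb C\to\Lambda^\tau(\mathbb C^\times,G)$ such that $F_\zeta(0)$ is an element of $G_0$ independent of $\zeta$ and $$F_\zeta^{-1}dF_\zeta=\alpha_\zeta=\zeta^{-2}\alpha_{-2}+\zeta^{-1}\alpha_{-1}+\alpha_0+\zeta\alpha_1+\zeta^2\alpha_2,$$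 where the $\alpha_j$ are smooth $\mathfrak g^{\mathbb C}$-valued $1$-forms on $\mathbb C$ with $\overline{\alpha_j}=\alpha_{-j}$, $\alpha_{-1}$ and $\alpha_{-2}$ are of type $(1,0)$, and $\alpha_{-2}+\alpha_2=-i\pi\mu\,\mathrm{diag}(1,1,-2)$. ($\alpha_{-1}$ is allowed to vanish.) **Polynomial Killing fields.** An adapted polynomial Killing field of degree $4d+2$ ($d\ge0$ an integer) for $\alpha_\zeta$ is a smooth family $\xi(z)=\sum_{|j|\le 4d+2}\zeta^j\xi_j(z)$, $z\in\mathbb C$, of Laurent polynomials in $\Lambda^\tau(\mathbb C^\times,\mathfrak g)$ such that $d\xi=[\xi,\alpha_\zeta]$, $\xi_{-4d-2}=\alpha_{-2}(\partial/\partial z)$ and $\xi_{-4d-1}=\alpha_{-1}(\partial/\partial z)$. **Theorem.** Let $0<\epsilon<1$, let $F_\zeta\in\hat{\mathcal E}(\mu)$, let $\xi$ be an adapted polynomial Killing field of degree $4d+2$ for $\alpha_\zeta=F_\zeta^{-1}dF_\zeta$, and set $\eta=\zeta^{4d}\xi(0)$. Then: 1. $\eta\in\Lambda^\epsilon_{-2,\infty}$.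 2. For every $z\in\mathbb C$ the loop $\exp(z\eta)$ on $C_\epsilon$ factorises as $\exp(z\eta)=g_Eg_I$ with $g_E\in\Lambda^\tau(E_\epsilon,G)$ and $g_I\in\Lambda^\tau_B(I_\epsilon,G)$. The factor $g_E=\exp(z\eta)_E$ is unique and extends to an element $\Phi(\eta)(z)$ of $\Lambda^\tau(\mathbb C^\times,G)$. The map $\Phi(\eta)=\exp(z\eta)_E$ given by the Symes map belongs to $\hat{\mathcal E}(\mu)$. 3. If $F_\zeta(0)=I$, then $[F_\zeta]=[\Phi(\eta)]$, i.e. $F_\zeta=\Phi(\eta)k$ for some $k\in\mathcal G_0$. For an arbitrary initial value $F_\zeta(0)\in G_0$, $[F_\zeta]=[F_\zeta(0)\,\Phi(\eta)]$. -/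

import Mathlib

noncomputable section

namespace HSL

open Complex Matrix

/-- Complex `3 × 3` matrices. -/
abbrev M3 : Type := Matrix (Fin 3) (Fin 3) ℂ

/-! ### The group `SL₃(ℂ)`, its real form `SU(3)` and the order four automorphism `τ` -/

/-- `S = diag(J, 1)` with `J = (0 1; -1 0)`. -/
def S : M3 := !![0, 1, 0; -1, 0, 0; 0, 0, 1]

/-- `τ(g) = S (gᵗ)⁻¹ S⁻¹` on the group. -/
def tauGrp (g : M3) : M3 := S * (gᵀ)⁻¹ * S⁻¹

/-- The automorphism induced by `τ` on the Lie algebra. -/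
def tauAlg (X : M3) : M3 := -(S * Xᵀ * S⁻¹)

/-- Conjugation of the complexified group with respect to the real form `SU(3)`. -/
def conjGrp (g : M3) : M3 := (gᴴ)⁻¹

/-- Conjugation of `sl₃(ℂ)` with respect to the real form `su(3)`. -/
def conjAlg (X : M3) : M3 := -Xᴴ

/-- The complexification of `G₀`: the fixed points of `τ` in `SL₃(ℂ)`. -/
def G0C : Set M3 := {g | g.det = 1 ∧ tauGrp g = g}

/-- `G₀`: the fixed points of `τ` in `SU(3)`. -/
def G0 : Set M3 := {g | g ∈ G0C ∧ gᴴ * g = 1}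

/-- `B`: upper triangular matrices in the complexification of `G₀` with positive real diagonal. -/
def B : Set M3 :=
  {b | b ∈ G0C ∧ (∀ i j : Fin 3, j < i → b i j = 0) ∧ ∀ i : Fin 3, ∃ r : ℝ, 0 < r ∧ b i i = (r : ℂ)}

/-- The generator `diag(1, 1, -2)` of `𝔤₂`. -/
def D : M3 := !![1, 0, 0; 0, 1, 0; 0, 0, -2]

/-! ### The Riemann sphere and its subsets -/

/-- `ζ ↦ ζ⁻¹` on the Riemann sphere. -/
def sphereInv : OnePoint ℂ → OnePoint ℂ
  | .infty => ((0 : ℂ) : OnePoint ℂ)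
  | .some ζ => if ζ = 0 then .infty else ((ζ⁻¹ : ℂ) : OnePoint ℂ)

/-- The real involution, the inverse of the complex conjugate of `ζ`. -/
def realInv : OnePoint ℂ → OnePoint ℂ
  | .infty => ((0 : ℂ) : OnePoint ℂ)
  | .some ζ => if ζ = 0 then .infty else (((starRingEnd ℂ ζ)⁻¹ : ℂ) : OnePoint ℂ)

/-- `ζ ↦ iζ` on the Riemann sphere. -/
def rotI : OnePoint ℂ → OnePoint ℂ
  | .infty => .infty
  | .some ζ => ((I * ζ : ℂ) : OnePoint ℂ)

/-- Holomorphy of a function on the sphere near a point (in the chart `1/ζ` near `∞`). -/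
def AnalyticAtSphere (f : OnePoint ℂ → ℂ) : OnePoint ℂ → Prop
  | .infty => AnalyticAt ℂ (fun w : ℂ => f (sphereInv (w : OnePoint ℂ))) 0
  | .some ζ => AnalyticAt ℂ (fun w : ℂ => f (w : OnePoint ℂ)) ζ

/-- `ℂ∖{0}` in the sphere. -/
def punctured : Set (OnePoint ℂ) := (fun w : ℂ => (w : OnePoint ℂ)) '' {w | w ≠ 0}

/-- `C_ε`: the union of the circles of radius `ε` and `ε⁻¹`. -/
def circles (ε : ℝ) : Set (OnePoint ℂ) :=
  (fun w : ℂ => (w : OnePoint ℂ)) '' {w | ‖w‖ = ε ∨ ‖w‖ = ε⁻¹}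

/-- `E_ε`: the closed annulus bounded by `C_ε`. -/
def annulus (ε : ℝ) : Set (OnePoint ℂ) :=
  (fun w : ℂ => (w : OnePoint ℂ)) '' {w | ε ≤ ‖w‖ ∧ ‖w‖ ≤ ε⁻¹}

/-- `I_ε`: the union of the closed discs around `0` and `∞` bounded by `C_ε`. -/
def discs (ε : ℝ) : Set (OnePoint ℂ) :=
  (fun w : ℂ => (w : OnePoint ℂ)) '' {w | ‖w‖ ≤ ε ∨ ε⁻¹ ≤ ‖w‖} ∪ {OnePoint.infty}

/-! ### Twisted loops -/

/-- A matrix valued function on the sphere. A map defined on a subset `Δ` only is represented by any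
of its extensions, so that equality of such maps is equality on `Δ`. -/
abbrev Loop : Type := OnePoint ℂ → M3

/-- Analyticity on `Δ`: each entry is holomorphic near each point of `Δ`. -/
def AnalyticOnSphere (Δ : Set (OnePoint ℂ)) (g : Loop) : Prop :=
  ∀ ζ ∈ Δ, ∀ i j : Fin 3, AnalyticAtSphere (fun w => g w i j) ζ

/-- `Λ^τ(Δ, G)`: analytic maps from `Δ` to `SL₃(ℂ)` with the real symmetry and `τ`-equivariance. -/
def loopGroup (Δ : Set (OnePoint ℂ)) : Set Loop :=
  {g | AnalyticOnSphere Δ g ∧ ∀ ζ ∈ Δ,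
    (g ζ).det = 1 ∧ conjGrp (g ζ) = g (realInv ζ) ∧ tauGrp (g ζ) = g (rotI ζ)}

/-- `Λ^τ(Δ, 𝔤)`: analytic maps from `Δ` to `sl₃(ℂ)` with the real symmetry and `τ`-equivariance. -/
def loopAlgebra (Δ : Set (OnePoint ℂ)) : Set Loop :=
  {ξ | AnalyticOnSphere Δ ξ ∧ ∀ ζ ∈ Δ,
    (ξ ζ).trace = 0 ∧ conjAlg (ξ ζ) = ξ (realInv ζ) ∧ tauAlg (ξ ζ) = ξ (rotI ζ)}

/-- `Λ^τ_B(I_ε, G)`: the loops in `Λ^τ(I_ε, G)` whose value at `ζ = 0` lies in `B`. -/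
def loopGroupB (ε : ℝ) : Set Loop :=
  {g | g ∈ loopGroup (discs ε) ∧ g ((0 : ℂ) : OnePoint ℂ) ∈ B}

/-- Multiplication by the scalar function `f` on the part of a loop inside the unit circle, with the
part outside the unit circle multiplied so that the real symmetry is kept. For a loop on `C_ε` this is
multiplication of the loop on the circle of radius `ε`, which determines the other one. -/
def innerMul (f : ℂ → ℂ) (ξ : Loop) : Loop
  | .infty => 0
  | .some ζ =>
    (if ‖ζ‖ < 1 then f ζ else starRingEnd ℂ (f (starRingEnd ℂ ζ)⁻¹)) • ξ (ζ : OnePoint ℂ)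

/-- `Λ^ε_{-2,∞}`: the `ξ ∈ Λ^τ(C_ε, 𝔤)` for which `ζ²ξ` extends holomorphically to `I_ε`. -/
def loopAlgebraM2 (ε : ℝ) : Set Loop :=
  {ξ | ξ ∈ loopAlgebra (circles ε) ∧
    ∃ h : Loop, AnalyticOnSphere (discs ε) h ∧ Set.EqOn h (innerMul (fun ζ => ζ ^ 2) ξ) (circles ε)}

/-! ### The factorisation and the Symes map -/

/-- `g_E` is the first factor in a factorisation `g = g_E g_I` on `C_ε` with
`g_E ∈ Λ^τ(E_ε, G)` and `g_I ∈ Λ^τ_B(I_ε, G)`. -/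
def IsEFactor (ε : ℝ) (g gE : Loop) : Prop :=
  gE ∈ loopGroup (annulus ε) ∧ ∃ gI ∈ loopGroupB ε, ∀ ζ ∈ circles ε, g ζ = gE ζ * gI ζ

/-- The loop `exp(zη)`. -/
def expLoop (η : Loop) (z : ℂ) : Loop :=
  fun ζ => NormedSpace.exp (innerMul (fun _ => z) η ζ)

open Classical in
/-- The Symes map `Φ(η) = exp(zη)_E`, as a map with values in `Λ^τ(ℂ∖{0}, G)`: at each `z` it is the
loop on `ℂ∖{0}` whose restriction to `E_ε` is the factor `exp(zη)_E`. -/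
def symesMap (ε : ℝ) (η : Loop) (z : ℂ) : Loop :=
  if h : ∃ g ∈ loopGroup punctured, IsEFactor ε (expLoop η z) g then h.choose else 1

/-! ### Smooth maps and one-forms on `ℂ` -/

/-- Smoothness of a matrix valued function on `ℂ = ℝ²`. -/
def SmoothMat (f : ℂ → M3) : Prop :=
  ∀ i j : Fin 3, ContDiff ℝ ((⊤ : ℕ∞) : WithTop ℕ∞) (fun z => f z i j)

/-- The value `df_z(v)` of the differential of a matrix valued function. -/
def dMat (f : ℂ → M3) (z v : ℂ) : M3 :=
  Matrix.of fun i j => fderiv ℝ (fun w => f w i j) z v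

/-- Matrix valued one-forms on `ℂ`. -/
abbrev OneForm : Type := ℂ → ℂ →ₗ[ℝ] M3

/-- A one-form of type `(1,0)`. -/
def IsType10 (β : OneForm) : Prop := ∀ z v : ℂ, β z (I * v) = I • β z v

/-- `β(∂/∂z)`, where `∂/∂z = (∂/∂x - i ∂/∂y)/2`. -/
def ddz (β : OneForm) (z : ℂ) : M3 := (1 / 2 : ℂ) • (β z 1 - I • β z I)

/-- `α_ζ = ζ⁻²α₋₂ + ζ⁻¹α₋₁ + α₀ + ζα₁ + ζ²α₂`. Only the indices from `-2` to `2` are used. -/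
def extForm (α : ℤ → OneForm) (ζ z v : ℂ) : M3 :=
  ∑ j ∈ Finset.Icc (-2 : ℤ) 2, ζ ^ j • α j z v

/-! ### The enlarged space of extended frames -/

/-- `F` is a based extended frame in the enlarged space of Maslov form `μ` (a constant real one-form),
and `α_ζ = F⁻¹dF` is its Maurer-Cartan form. The coefficients `α_j` take values in `sl₃(ℂ)`, and in the
appropriate eigenspaces of `τ`, because `F` takes values in `Λ^τ(ℂ∖{0}, G)`. The form `α₋₁` may vanish. -/
structure IsExtendedFrame (μ : ℂ →ₗ[ℝ] ℝ) (F : ℂ → Loop) (α : ℤ → OneForm) : Prop where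
  loop : ∀ z : ℂ, F z ∈ loopGroup punctured
  smooth : ∀ i j : Fin 3, ContDiffOn ℝ ((⊤ : ℕ∞) : WithTop ℕ∞)
    (fun p : ℂ × ℂ => F p.1 (p.2 : OnePoint ℂ) i j) {p | p.2 ≠ 0}
  based : ∃ k ∈ G0, ∀ ζ ∈ punctured, F 0 ζ = k
  smooth_form : ∀ j ∈ Finset.Icc (-2 : ℤ) 2, ∀ v : ℂ, SmoothMat (fun z => α j z v)
  maurerCartan : ∀ ζ : ℂ, ζ ≠ 0 → ∀ z v : ℂ,
    (F z (ζ : OnePoint ℂ))⁻¹ * dMat (fun w => F w (ζ : OnePoint ℂ)) z v = extForm α ζ z v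
  real : ∀ j ∈ Finset.Icc (-2 : ℤ) 2, ∀ z v : ℂ, conjAlg (α j z v) = α (-j) z v
  type_neg_two : IsType10 (α (-2))
  type_neg_one : IsType10 (α (-1))
  maslov : ∀ z v : ℂ, α (-2) z v + α 2 z v = (-(I * (Real.pi : ℂ) * (μ v : ℂ))) • D

/-- The enlarged space of based extended frames of Maslov form `μ`. -/
def extendedFrames (μ : ℂ →ₗ[ℝ] ℝ) : Set (ℂ → Loop) :=
  {F | ∃ α : ℤ → OneForm, IsExtendedFrame μ F α}

/-- `[F] = [H]`: the two frames differ by right multiplication by an element of the gauge group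
of smooth maps from `ℂ` to `G₀`. -/
def GaugeEquiv (F H : ℂ → Loop) : Prop :=
  ∃ k : ℂ → M3, SmoothMat k ∧ (∀ z, k z ∈ G0) ∧ ∀ z : ℂ, ∀ ζ ∈ punctured, F z ζ = H z ζ * k z

/-! ### Polynomial Killing fields -/

/-- `ξ` is an adapted polynomial Killing field of degree `4d + 2` for `α_ζ`. No periodicity in `z` is
imposed. The real symmetry bounds the powers of `ζ` from above once they are bounded from below. -/
structure IsAdaptedKillingField (α : ℤ → OneForm) (d : ℕ) (ξ : ℂ → Loop) : Prop where
  loop : ∀ z : ℂ, ξ z ∈ loopAlgebra punctured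
  lax : ∀ ζ : ℂ, ζ ≠ 0 → ∀ z v : ℂ,
    dMat (fun w => ξ w (ζ : OnePoint ℂ)) z v =
      ξ z (ζ : OnePoint ℂ) * extForm α ζ z v - extForm α ζ z v * ξ z (ζ : OnePoint ℂ)
  adapted : ∃ c : ℤ → ℂ → M3, (∀ j, SmoothMat (c j)) ∧
    (∀ ζ : ℂ, ζ ≠ 0 → ∀ z : ℂ, ξ z (ζ : OnePoint ℂ) =
      ∑ j ∈ Finset.Icc (-(4 * (d : ℤ) + 2)) (4 * (d : ℤ) + 2), ζ ^ j • c j z) ∧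
    (∀ z : ℂ, c (-(4 * (d : ℤ)) - 2) z = ddz (α (-2)) z) ∧
    (∀ z : ℂ, c (-(4 * (d : ℤ)) - 1) z = ddz (α (-1)) z)

/-- `η = ζ^{4d} ξ(0)`, as a loop on `C_ε`. -/
def symesDatum (d : ℕ) (ξ : ℂ → Loop) : Loop := innerMul (fun ζ => ζ ^ (4 * d)) (ξ 0)

end HSL

end

noncomputable section

namespace HSL

open Complex Matrix
open scoped ComplexConjugate Topology

/-! ### Holomorphic matrix valued functions -/

/-! The frame itself supplies the factorisation of exp(zη), so no general Iwasawa theorem for loop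
groups is needed. The Lax equation says that F ξ F⁻¹ is constant in z (`killing_conj`). Put H(z, ζ)
= F(z)⁻¹ F(0) exp(z ζ^{4d} ξ(0)), so that exp(zη) = F(0)⁻¹ F(z) · H(z) on the inner circle. The
first factor is a twisted loop on all of ℂ∖{0}; the point is that the second one extends
holomorphically to ζ = 0.

Along the ray t ↦ tz, H solves a linear equation whose coefficient is z ζ^{4d} ξ(tz) − α_ζ(z), the
form being taken at tz (`hasDerivAt_innerFactor`). Its only possible polar terms have orders 2 and 1
in ζ, and they cancel: α₋₂ and α₋₁ are complex linear because of type (1,0), and adaptedness makes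
the two lowest coefficients of ξ equal to their values on ∂/∂z. The coefficient is therefore bounded
uniformly in 0 < |ζ| ≤ 1 (`exists_bound_innerFactor_ode`), Grönwall's inequality bounds H, and
Riemann's theorem removes the singularity (`exists_innerFactor_extension`).

The value H(z, 0) is fixed by τ, hence lies in a copy of SL₂(ℂ), but need not lie in B. Gram–Schmidt
gives H(z, 0) = k(z) b(z) with k(z) in G₀ and b(z) in B, and k depends smoothly on z because H(z, 0)
is a circle average of H. Moving k across yields exp(zη) = (F(0)⁻¹ F(z) k(z)) (k(z)⁻¹ H(z)), which
is the required factorisation (`exists_gauge_isEFactor`).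

First factors are unique: the quotient of two of them continues to the whole sphere, is constant by
Liouville, and is both unitary and in B, hence 1 (`IsEFactor.eqOn`). Thus Φ(η) = F(0)⁻¹ F k on
ℂ∖{0}. Membership in the frame space is then invariance under gauge transformations
(`IsExtendedFrame.gauge`), and the gauge equivalences are this identity solved for F. -/

/-- Holomorphy, entry by entry, of a matrix valued function near a point. -/
def EntryAnalyticAt (h : ℂ → M3) (z : ℂ) : Prop := ∀ i j, AnalyticAt ℂ (fun w => h w i j) z

lemma EntryAnalyticAt.mul {g h : ℂ → M3} {z : ℂ} (hg : EntryAnalyticAt g z)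
    (hh : EntryAnalyticAt h z) : EntryAnalyticAt (fun w => g w * h w) z := by
  intro i j
  simp only [Matrix.mul_apply]
  exact Finset.analyticAt_fun_sum _ fun k _ => (hg i k).mul (hh k j)

lemma entryAnalyticAt_const (m : M3) (z : ℂ) : EntryAnalyticAt (fun _ => m) z :=
  fun _ _ => analyticAt_const

lemma EntryAnalyticAt.neg {h : ℂ → M3} {z : ℂ} (hh : EntryAnalyticAt h z) :
    EntryAnalyticAt (fun w => -h w) z :=
  fun i j => (hh i j).neg

lemma EntryAnalyticAt.smul {f : ℂ → ℂ} {h : ℂ → M3} {z : ℂ} (hf : AnalyticAt ℂ f z)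
    (hh : EntryAnalyticAt h z) : EntryAnalyticAt (fun w => f w • h w) z :=
  fun i j => hf.mul (hh i j)

lemma EntryAnalyticAt.congr {g h : ℂ → M3} {z : ℂ} (hg : EntryAnalyticAt g z)
    (hgh : g =ᶠ[𝓝 z] h) : EntryAnalyticAt h z :=
  fun i j => (hg i j).congr (hgh.mono fun w hw => by simp only [hw])

lemma EntryAnalyticAt.comp {h : ℂ → M3} {f : ℂ → ℂ} {z : ℂ} (hh : EntryAnalyticAt h (f z))
    (hf : AnalyticAt ℂ f z) : EntryAnalyticAt (fun w => h (f w)) z :=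
  fun i j => (hh i j).comp hf

lemma EntryAnalyticAt.det {h : ℂ → M3} {z : ℂ} (hh : EntryAnalyticAt h z) :
    AnalyticAt ℂ (fun w => (h w).det) z := by
  simp only [Matrix.det_fin_three]
  exact ((((((hh 0 0).fun_mul (hh 1 1)).fun_mul (hh 2 2)).fun_sub
    (((hh 0 0).fun_mul (hh 1 2)).fun_mul (hh 2 1))).fun_sub
    (((hh 0 1).fun_mul (hh 1 0)).fun_mul (hh 2 2))).fun_add
    (((hh 0 1).fun_mul (hh 1 2)).fun_mul (hh 2 0))).fun_add
    (((hh 0 2).fun_mul (hh 1 0)).fun_mul (hh 2 1)) |>.fun_sub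
    (((hh 0 2).fun_mul (hh 1 1)).fun_mul (hh 2 0))

lemma EntryAnalyticAt.adjugate {h : ℂ → M3} {z : ℂ} (hh : EntryAnalyticAt h z) :
    EntryAnalyticAt (fun w => (h w).adjugate) z := by
  intro i j
  simp only [Matrix.adjugate_apply]
  refine EntryAnalyticAt.det (h := fun w => (h w).updateRow j (Pi.single i 1)) ?_
  intro k l
  by_cases hk : k = j
  · subst hk; simp only [Matrix.updateRow_self]; exact analyticAt_const
  · simp only [Matrix.updateRow_ne hk]; exact hh k l

lemma EntryAnalyticAt.inv {h : ℂ → M3} {z : ℂ} (hh : EntryAnalyticAt h z)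
    (hz : (h z).det = 1) : EntryAnalyticAt (fun w => (h w)⁻¹) z := by
  simp only [Matrix.inv_def, Ring.inverse_eq_inv']
  exact EntryAnalyticAt.smul (hh.det.inv (by simp [hz])) hh.adjugate

lemma analyticAt_conj_conj {f : ℂ → ℂ} {z : ℂ} (hf : AnalyticAt ℂ f (conj z)) :
    AnalyticAt ℂ (fun w => conj (f (conj w))) z := by
  rw [Complex.analyticAt_iff_eventually_differentiableAt] at hf ⊢
  have := (Complex.continuous_conj.tendsto z).eventually hf
  filter_upwards [this] with w hw
  exact differentiableAt_conj_conj_iff.2 hw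

lemma EntryAnalyticAt.conjTranspose_conj {h : ℂ → M3} {z : ℂ} (hh : EntryAnalyticAt h (conj z)) :
    EntryAnalyticAt (fun w => (h (conj w))ᴴ) z :=
  fun i j => analyticAt_conj_conj (hh j i)

lemma EntryAnalyticAt.conjAlg_conj {h : ℂ → M3} {z : ℂ} (hh : EntryAnalyticAt h (conj z)) :
    EntryAnalyticAt (fun w => conjAlg (h (conj w))) z :=
  hh.conjTranspose_conj.neg

lemma EntryAnalyticAt.conjGrp_conj {h : ℂ → M3} {z : ℂ} (hh : EntryAnalyticAt h (conj z))
    (hd : (h (conj z)).det = 1) : EntryAnalyticAt (fun w => conjGrp (h (conj w))) z :=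
  hh.conjTranspose_conj.inv (by simp [Matrix.det_conjTranspose, hd])

/-! ### Charts of the sphere -/

@[simp] lemma realInv_coe {ζ : ℂ} (h : ζ ≠ 0) :
    realInv (ζ : OnePoint ℂ) = (((conj ζ)⁻¹ : ℂ) : OnePoint ℂ) := if_neg h

@[simp] lemma realInv_zero : realInv ((0 : ℂ) : OnePoint ℂ) = OnePoint.infty := if_pos rfl

@[simp] lemma realInv_infty : realInv OnePoint.infty = ((0 : ℂ) : OnePoint ℂ) := rfl

@[simp] lemma rotI_coe (ζ : ℂ) : rotI (ζ : OnePoint ℂ) = ((I * ζ : ℂ) : OnePoint ℂ) := rfl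

@[simp] lemma rotI_infty : rotI OnePoint.infty = OnePoint.infty := rfl

lemma sphereInv_coe {ζ : ℂ} (h : ζ ≠ 0) :
    sphereInv (ζ : OnePoint ℂ) = ((ζ⁻¹ : ℂ) : OnePoint ℂ) := if_neg h

lemma sphereInv_zero : sphereInv ((0 : ℂ) : OnePoint ℂ) = OnePoint.infty := if_pos rfl

/-- The standard holomorphic chart of the sphere around a point. -/
def chart : OnePoint ℂ → ℂ → OnePoint ℂ
  | .infty => fun w => sphereInv (w : OnePoint ℂ)
  | .some _ => fun w => (w : OnePoint ℂ)

/-- The coordinate of a point in the chart around it. -/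
def chartPt : OnePoint ℂ → ℂ
  | .infty => 0
  | .some ζ => ζ

lemma chart_chartPt (p : OnePoint ℂ) : chart p (chartPt p) = p := by
  induction p using OnePoint.rec
  · exact sphereInv_zero
  · rfl

lemma analyticAtSphere_iff (f : OnePoint ℂ → ℂ) (p : OnePoint ℂ) :
    AnalyticAtSphere f p ↔ AnalyticAt ℂ (fun w => f (chart p w)) (chartPt p) := by
  induction p using OnePoint.rec <;> rfl

lemma analyticOnSphere_iff (Δ : Set (OnePoint ℂ)) (g : Loop) :
    AnalyticOnSphere Δ g ↔ ∀ p ∈ Δ, EntryAnalyticAt (fun w => g (chart p w)) (chartPt p) := by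
  simp only [AnalyticOnSphere, analyticAtSphere_iff, EntryAnalyticAt]

lemma AnalyticOnSphere.entryAnalyticAt {Δ : Set (OnePoint ℂ)} {g : Loop}
    (hg : AnalyticOnSphere Δ g) {ζ : ℂ} (hζ : (ζ : OnePoint ℂ) ∈ Δ) :
    EntryAnalyticAt (fun w => g (w : OnePoint ℂ)) ζ :=
  hg _ hζ

lemma AnalyticOnSphere.mono {Δ Δ' : Set (OnePoint ℂ)} {g : Loop} (h : Δ ⊆ Δ')
    (hg : AnalyticOnSphere Δ' g) : AnalyticOnSphere Δ g :=
  fun ζ hζ => hg ζ (h hζ)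

lemma coe_mem_circles {ε : ℝ} {ζ : ℂ} :
    (ζ : OnePoint ℂ) ∈ circles ε ↔ ‖ζ‖ = ε ∨ ‖ζ‖ = ε⁻¹ := by
  simp [circles]

lemma coe_mem_annulus {ε : ℝ} {ζ : ℂ} :
    (ζ : OnePoint ℂ) ∈ annulus ε ↔ ε ≤ ‖ζ‖ ∧ ‖ζ‖ ≤ ε⁻¹ := by
  simp [annulus]

lemma coe_mem_discs {ε : ℝ} {ζ : ℂ} :
    (ζ : OnePoint ℂ) ∈ discs ε ↔ ‖ζ‖ ≤ ε ∨ ε⁻¹ ≤ ‖ζ‖ := by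
  simp [discs]

lemma infty_mem_discs {ε : ℝ} : OnePoint.infty ∈ discs ε := by simp [discs]

lemma coe_mem_punctured {ζ : ℂ} : (ζ : OnePoint ℂ) ∈ punctured ↔ ζ ≠ 0 := by
  simp [punctured]

lemma mem_circles {ε : ℝ} {p : OnePoint ℂ} (hp : p ∈ circles ε) :
    ∃ ζ : ℂ, p = ζ ∧ (‖ζ‖ = ε ∨ ‖ζ‖ = ε⁻¹) := by
  obtain ⟨ζ, h, rfl⟩ := hp; exact ⟨ζ, rfl, h⟩

lemma mem_annulus {ε : ℝ} {p : OnePoint ℂ} (hp : p ∈ annulus ε) :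
    ∃ ζ : ℂ, p = ζ ∧ ε ≤ ‖ζ‖ ∧ ‖ζ‖ ≤ ε⁻¹ := by
  obtain ⟨ζ, h, rfl⟩ := hp; exact ⟨ζ, rfl, h⟩

lemma mem_punctured {p : OnePoint ℂ} (hp : p ∈ punctured) : ∃ ζ : ℂ, p = ζ ∧ ζ ≠ 0 := by
  obtain ⟨ζ, h, rfl⟩ := hp; exact ⟨ζ, rfl, h⟩

lemma circles_subset_annulus {ε : ℝ} (hε0 : 0 < ε) (hε1 : ε < 1) : circles ε ⊆ annulus ε := by
  have := one_lt_inv_iff₀.2 ⟨hε0, hε1⟩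
  rintro _ ⟨ζ, h | h, rfl⟩ <;> exact coe_mem_annulus.2 (by constructor <;> linarith)

lemma circles_subset_discs {ε : ℝ} : circles ε ⊆ discs ε := by
  rintro _ ⟨ζ, h | h, rfl⟩
  · exact coe_mem_discs.2 (Or.inl h.le)
  · exact coe_mem_discs.2 (Or.inr h.ge)

lemma annulus_subset_punctured {ε : ℝ} (hε0 : 0 < ε) : annulus ε ⊆ punctured := by
  rintro _ ⟨ζ, h, rfl⟩
  exact coe_mem_punctured.2 (norm_pos_iff.1 (hε0.trans_le h.1))

/-! ### Identity theorem and Liouville's theorem -/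

lemma eventually_lt_norm {r : ℝ} {w : ℂ} (h : r < ‖w‖) : ∀ᶠ v in 𝓝 w, r < ‖v‖ :=
  (isOpen_lt continuous_const continuous_norm).mem_nhds h

lemma eventually_norm_lt {r : ℝ} {w : ℂ} (h : ‖w‖ < r) : ∀ᶠ v in 𝓝 w, ‖v‖ < r :=
  (isOpen_lt continuous_norm continuous_const).mem_nhds h

/-- A circle has no isolated points, so the identity theorem applies at each of its points. This
upgrades agreement on the circle to agreement near it, which is what gluing across the circle
requires. -/
lemma eventuallyEq_of_eqOn_sphere {f g : ℂ → ℂ} {r : ℝ} (hr : 0 < r) {z : ℂ} (hz : ‖z‖ = r)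
    (hf : AnalyticAt ℂ f z) (hg : AnalyticAt ℂ g z) (h : ∀ w : ℂ, ‖w‖ = r → f w = g w) :
    f =ᶠ[𝓝 z] g := by
  refine (hf.frequently_eq_iff_eventually_eq hg).1 ?_
  have hz' : z ∈ Metric.sphere (0 : ℂ) r := by simpa using hz
  have hnt : (Metric.sphere (0 : ℂ) r).Nontrivial := by
    refine ⟨z, hz', -z, by simpa using hz, fun h0 => ?_⟩
    have : z = 0 := by simpa [eq_comm, self_eq_neg] using h0
    rw [this, norm_zero] at hz; exact hr.ne hz
  have hpc : IsPreconnected (Metric.sphere (0 : ℂ) r) :=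
    isPreconnected_sphere (by rw [Complex.rank_real_complex]; norm_num) _ _
  have hacc := hpc.preperfect_of_nontrivial hnt z hz'
  refine (accPt_iff_frequently_nhdsNE.1 hacc).mono fun w hw => h w (by simpa using hw)

/-- The two functions glue to an entire function with a finite limit at infinity, and Liouville's
theorem makes it constant. -/
lemma exists_const_of_eqOn_circles {ε : ℝ} (hε0 : 0 < ε) (hε1 : ε < 1) {f g : OnePoint ℂ → ℂ}
    (hf : ∀ p ∈ annulus ε, AnalyticAtSphere f p) (hg : ∀ p ∈ discs ε, AnalyticAtSphere g p)
    (h : Set.EqOn f g (circles ε)) :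
    ∃ c, (∀ p ∈ annulus ε, f p = c) ∧ ∀ p ∈ discs ε, g p = c := by
  have hεi := one_lt_inv_iff₀.2 ⟨hε0, hε1⟩
  set φ : ℂ → ℂ := fun w => if ε ≤ ‖w‖ ∧ ‖w‖ ≤ ε⁻¹ then f w else g w with hφ
  have hcirc : ∀ r, (r = ε ∨ r = ε⁻¹) → ∀ w : ℂ, ‖w‖ = r → f w = g w := by
    rintro r hr w rfl
    exact h (coe_mem_circles.2 hr)
  have hdiff : Differentiable ℂ φ := by
    intro w
    by_cases hc : ‖w‖ = ε ∨ ‖w‖ = ε⁻¹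
    · have hfa := hf w (circles_subset_annulus hε0 hε1 (coe_mem_circles.2 hc))
      have hga := hg w (circles_subset_discs (coe_mem_circles.2 hc))
      have hev := eventuallyEq_of_eqOn_sphere (r := ‖w‖) (by rcases hc with h | h <;> rw [h] <;> linarith)
        rfl hfa hga (hcirc _ hc)
      refine (AnalyticAt.congr hfa ?_).differentiableAt
      filter_upwards [hev] with v hv
      simp only [hφ]
      split_ifs
      · rfl
      · exact hv
    · push Not at hc
      by_cases ha : ε ≤ ‖w‖ ∧ ‖w‖ ≤ ε⁻¹
      · have hfa := hf w (coe_mem_annulus.2 ha)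
        have h1 := lt_of_le_of_ne ha.1 hc.1.symm
        have h2 := lt_of_le_of_ne ha.2 hc.2
        refine (AnalyticAt.congr hfa ?_).differentiableAt
        filter_upwards [eventually_lt_norm h1, eventually_norm_lt h2] with v hv1 hv2
        simp only [hφ, hv1.le, hv2.le, and_self, if_true]
      · have hga : AnalyticAtSphere g (w : OnePoint ℂ) := hg w (coe_mem_discs.2 (by
          by_contra hcon; push Not at hcon; exact ha ⟨hcon.1.le, hcon.2.le⟩))
        refine (AnalyticAt.congr hga ?_).differentiableAt
        have : IsOpen {v : ℂ | ¬ (ε ≤ ‖v‖ ∧ ‖v‖ ≤ ε⁻¹)} := by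
          refine isOpen_compl_iff.2 (IsClosed.inter ?_ ?_)
          · exact isClosed_le continuous_const continuous_norm
          · exact isClosed_le continuous_norm continuous_const
        filter_upwards [this.mem_nhds ha] with v hv
        simp only [hφ, if_neg hv]
  -- Continuity of g at ∞ in the chart 1/w gives the limit, since φ is g outside the annulus.
  have hlim : Filter.Tendsto φ (Filter.cocompact ℂ) (𝓝 (g OnePoint.infty)) := by
    have hga : AnalyticAt ℂ (fun w : ℂ => g (sphereInv (w : OnePoint ℂ))) 0 :=
      hg _ infty_mem_discs
    have h1 : Filter.Tendsto (fun w : ℂ => g (sphereInv (w⁻¹ : ℂ))) (Filter.cocompact ℂ)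
        (𝓝 (g OnePoint.infty)) := by
      have := hga.continuousAt.tendsto
      rw [sphereInv_zero] at this
      exact this.comp (Filter.tendsto_inv₀_cobounded.mono_left Metric.cobounded_eq_cocompact.ge)
    refine h1.congr' ?_
    have : ∀ᶠ w : ℂ in Filter.cocompact ℂ, ε⁻¹ < ‖w‖ :=
      (tendsto_norm_cocompact_atTop).eventually_gt_atTop _
    filter_upwards [this] with w hw
    have hw0 : w ≠ 0 := norm_pos_iff.1 (by linarith)
    rw [sphereInv_coe (inv_ne_zero hw0), inv_inv, hφ]
    simp only
    rw [if_neg (by intro h; linarith [h.2])]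
  refine ⟨g OnePoint.infty, fun p hp => ?_, fun p hp => ?_⟩
  · obtain ⟨w, rfl, hw⟩ := mem_annulus hp
    have := hdiff.apply_eq_of_tendsto_cocompact w hlim
    simp only [hφ, hw, and_self, if_true] at this
    exact this
  · induction p using OnePoint.rec with
    | infty => rfl
    | coe w =>
      have := hdiff.apply_eq_of_tendsto_cocompact w hlim
      simp only [hφ] at this
      split_ifs at this with hw
      · rw [← h (coe_mem_circles.2 ?_), this]
        rcases coe_mem_discs.1 hp with h' | h'
        · exact Or.inl (le_antisymm h' hw.1)
        · exact Or.inr (le_antisymm hw.2 h')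
      · exact this

/-- Functions holomorphic on `ℂ∖{0}` that agree on `E_ε` agree. -/
lemma eqOn_punctured_of_eqOn_annulus {ε : ℝ} (hε0 : 0 < ε) (hε1 : ε < 1) {g h : Loop}
    (hg : AnalyticOnSphere punctured g) (hh : AnalyticOnSphere punctured h)
    (heq : Set.EqOn g h (annulus ε)) : Set.EqOn g h punctured := by
  have hεi := one_lt_inv_iff₀.2 ⟨hε0, hε1⟩
  intro p hp
  obtain ⟨ζ, rfl, hζ⟩ := mem_punctured hp
  ext i j
  have hpc : IsPreconnected ({0}ᶜ : Set ℂ) :=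
    (isConnected_compl_singleton_of_one_lt_rank (by rw [Complex.rank_real_complex]; norm_num)
      (0 : ℂ)).isPreconnected
  have h1 : ∀ w : ℂ, w ≠ 0 → AnalyticAt ℂ (fun w : ℂ => g w i j) w :=
    fun w hw => hg w (coe_mem_punctured.2 hw) i j
  have h2 : ∀ w : ℂ, w ≠ 0 → AnalyticAt ℂ (fun w : ℂ => h w i j) w :=
    fun w hw => hh w (coe_mem_punctured.2 hw) i j
  refine AnalyticOnNhd.eqOn_of_preconnected_of_eventuallyEq (𝕜 := ℂ) (U := {0}ᶜ) (z₀ := 1)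
    (fun w hw => h1 w hw) (fun w hw => h2 w hw) hpc (by simp) ?_ hζ
  filter_upwards [eventually_lt_norm (w := 1) (by simpa using hε1),
    eventually_norm_lt (w := 1) (by simpa using hεi)] with w hw1 hw2
  rw [heq (coe_mem_annulus.2 ⟨hw1.le, hw2.le⟩)]

/-! ### The automorphism `τ` and the real structure -/

lemma S_mul_transpose : S * Sᵀ = 1 := by
  ext i j; fin_cases i <;> fin_cases j <;> simp [S, Matrix.mul_apply, Fin.sum_univ_three]

lemma S_inv : S⁻¹ = Sᵀ := Matrix.inv_eq_right_inv S_mul_transpose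

lemma S_transpose_mul : Sᵀ * S = 1 := mul_eq_one_comm.1 S_mul_transpose

lemma S_inv_mul : S⁻¹ * S = 1 := by rw [S_inv, S_transpose_mul]

lemma S_mul_inv : S * S⁻¹ = 1 := by rw [S_inv, S_mul_transpose]

lemma S_conjTranspose : Sᴴ = Sᵀ := by
  ext i j; fin_cases i <;> fin_cases j <;> simp [S]

lemma tauGrp_mul (a b : M3) : tauGrp (a * b) = tauGrp a * tauGrp b := by
  simp only [tauGrp, Matrix.transpose_mul, Matrix.mul_inv_rev]
  calc S * (aᵀ⁻¹ * bᵀ⁻¹) * S⁻¹ = S * aᵀ⁻¹ * 1 * bᵀ⁻¹ * S⁻¹ := by simp only [mul_assoc, mul_one]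
    _ = _ := by rw [← S_inv_mul]; simp only [mul_assoc]

lemma conjGrp_mul (a b : M3) : conjGrp (a * b) = conjGrp a * conjGrp b := by
  simp only [conjGrp, Matrix.conjTranspose_mul, Matrix.mul_inv_rev]

lemma tauGrp_one : tauGrp 1 = 1 := by simp [tauGrp, S_mul_inv]

lemma conjGrp_one : conjGrp 1 = 1 := by simp [conjGrp]

lemma isUnit_det_of_det_eq_one {a : M3} (h : a.det = 1) : IsUnit a.det := by simp [h]

lemma det_inv_eq_one {a : M3} (h : a.det = 1) : (a⁻¹).det = 1 := by
  rw [Matrix.det_nonsing_inv, h, Ring.inverse_one]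

lemma tauGrp_inv {a : M3} (h : a.det = 1) : tauGrp a⁻¹ = (tauGrp a)⁻¹ := by
  refine (Matrix.inv_eq_right_inv ?_).symm
  rw [← tauGrp_mul, Matrix.mul_nonsing_inv _ (isUnit_det_of_det_eq_one h), tauGrp_one]

lemma conjGrp_inv {a : M3} (h : a.det = 1) : conjGrp a⁻¹ = (conjGrp a)⁻¹ := by
  refine (Matrix.inv_eq_right_inv ?_).symm
  rw [← conjGrp_mul, Matrix.mul_nonsing_inv _ (isUnit_det_of_det_eq_one h), conjGrp_one]

lemma det_conjGrp {a : M3} (h : a.det = 1) : (conjGrp a).det = 1 :=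
  det_inv_eq_one (by simp [Matrix.det_conjTranspose, h])

lemma conjGrp_conjGrp {a : M3} (h : a.det = 1) : conjGrp (conjGrp a) = a := by
  simp only [conjGrp, Matrix.conjTranspose_nonsing_inv, Matrix.conjTranspose_conjTranspose]
  exact Matrix.nonsing_inv_nonsing_inv _ (isUnit_det_of_det_eq_one h)

/-- S is real orthogonal, hence fixed by the conjugation; inversion, transposition and conjugate
transposition then commute. -/
lemma tauGrp_conjGrp (a : M3) : tauGrp (conjGrp a) = conjGrp (tauGrp a) := by
  have h1 : conjGrp S = S := by
    rw [conjGrp, S_conjTranspose]; exact Matrix.inv_eq_left_inv S_mul_transpose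
  have h2 : conjGrp S⁻¹ = S⁻¹ := by
    rw [S_inv, conjGrp, ← S_conjTranspose, conjTranspose_conjTranspose, S_conjTranspose, S_inv]
  rw [tauGrp, tauGrp, conjGrp_mul, conjGrp_mul, h1, h2]
  simp only [conjGrp, Matrix.transpose_nonsing_inv, Matrix.conjTranspose_nonsing_inv]
  congr 3

lemma conjAlg_smul (c : ℂ) (X : M3) : conjAlg (c • X) = conj c • conjAlg X := by
  simp [conjAlg]

lemma tauAlg_smul (c : ℂ) (X : M3) : tauAlg (c • X) = c • tauAlg X := by
  simp [tauAlg]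

/-! ### The groups `G₀` and `B` -/

/-- Being fixed by τ amounts to preserving the bilinear form of S. In this shape it becomes
polynomial equations in the entries, without inverses. -/
lemma mul_S_mul_transpose {g : M3} (hg : g ∈ G0C) : g * S * gᵀ = S := by
  obtain ⟨hd, ht⟩ := hg
  have hu : IsUnit gᵀ.det := by simp [hd]
  calc g * S * gᵀ = tauGrp g * S * gᵀ := by rw [ht]
    _ = S * (gᵀ⁻¹ * (S⁻¹ * S) * gᵀ) := by simp only [tauGrp, mul_assoc]
    _ = S := by rw [S_inv_mul, mul_one, Matrix.nonsing_inv_mul _ hu, mul_one]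

lemma G0C_mul {a b : M3} (ha : a ∈ G0C) (hb : b ∈ G0C) : a * b ∈ G0C :=
  ⟨by rw [det_mul, ha.1, hb.1, one_mul], by rw [tauGrp_mul, ha.2, hb.2]⟩

lemma G0C_inv {a : M3} (ha : a ∈ G0C) : a⁻¹ ∈ G0C :=
  ⟨det_inv_eq_one ha.1, by rw [tauGrp_inv ha.1, ha.2]⟩

lemma G0_inv_eq {k : M3} (hk : k ∈ G0) : k⁻¹ = kᴴ := Matrix.inv_eq_left_inv hk.2

lemma G0_mul_conjTranspose {k : M3} (hk : k ∈ G0) : k * kᴴ = 1 := mul_eq_one_comm.1 hk.2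

lemma G0_conjTranspose {k : M3} (hk : k ∈ G0) : kᴴ ∈ G0 :=
  ⟨G0_inv_eq hk ▸ G0C_inv hk.1, by rw [conjTranspose_conjTranspose, G0_mul_conjTranspose hk]⟩

lemma conjGrp_of_mem_G0 {k : M3} (hk : k ∈ G0) : conjGrp k = k := by
  rw [conjGrp]; exact Matrix.inv_eq_left_inv (G0_mul_conjTranspose hk)

/-- The complexification of `G₀` is `SL₂(ℂ)`, embedded as the upper left block. -/
lemma G0C_entries {g : M3} (hg : g ∈ G0C) :
    g 0 2 = 0 ∧ g 1 2 = 0 ∧ g 2 0 = 0 ∧ g 2 1 = 0 ∧ g 2 2 = 1 ∧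
      g 0 0 * g 1 1 - g 0 1 * g 1 0 = 1 := by
  have h := mul_S_mul_transpose hg
  have e : ∀ i j : Fin 3, g i 0 * g j 1 - g i 1 * g j 0 + g i 2 * g j 2 = S i j := by
    intro i j
    rw [← h]
    simp [S, Matrix.mul_apply, Fin.sum_univ_three]
    ring
  -- On the diagonal the skew block of S cancels, leaving only the square of the entry in the third
  -- column.
  have e00 : g 0 2 * g 0 2 = 0 := by have := e 0 0; simp [S] at this; linear_combination this
  have e11 : g 1 2 * g 1 2 = 0 := by have := e 1 1; simp [S] at this; linear_combination this
  have h02 := mul_self_eq_zero.1 e00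
  have h12 := mul_self_eq_zero.1 e11
  have e01 : g 0 0 * g 1 1 - g 0 1 * g 1 0 = 1 := by
    have := e 0 1; simp [S, h02] at this; exact this
  have e02 : g 0 0 * g 2 1 - g 0 1 * g 2 0 = 0 := by
    have := e 0 2; simp [S, h02] at this; exact this
  have e12 : g 1 0 * g 2 1 - g 1 1 * g 2 0 = 0 := by
    have := e 1 2; simp [S, h12] at this; exact this
  -- The last row solves a homogeneous 2 × 2 system whose determinant is 1 by `e01`; the
  -- combinations are Cramer's rule.
  have h20 : g 2 0 = 0 := by linear_combination (-g 2 0) * e01 + g 1 0 * e02 - g 0 0 * e12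
  have h21 : g 2 1 = 0 := by linear_combination (-g 2 1) * e01 + g 1 1 * e02 - g 0 1 * e12
  have hd := hg.1
  rw [det_fin_three, h02, h12, h20, h21] at hd
  exact ⟨h02, h12, h20, h21, by linear_combination hd - g 2 2 * e01, e01⟩

lemma mem_G0C_of_block {a b c d : ℂ} (h : a * d - b * c = 1) :
    !![a, b, 0; c, d, 0; 0, 0, 1] ∈ G0C := by
  set g : M3 := !![a, b, 0; c, d, 0; 0, 0, 1] with hg
  have hd : g.det = 1 := by rw [det_fin_three]; simp [hg]; linear_combination h
  have hS : g * S * gᵀ = S := by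
    ext i j
    fin_cases i <;> fin_cases j <;>
      simp [hg, S, Matrix.mul_apply, Fin.sum_univ_three] <;>
      first | ring1 | linear_combination h | linear_combination -h
  have hu : IsUnit gᵀ.det := by simp [hd]
  refine ⟨hd, ?_⟩
  calc tauGrp g = g * S * gᵀ * gᵀ⁻¹ * S⁻¹ := by rw [hS]; rfl
    _ = g * S * (gᵀ * gᵀ⁻¹) * S⁻¹ := by simp only [mul_assoc]
    _ = g := by rw [Matrix.mul_nonsing_inv _ hu, mul_one, mul_assoc, S_mul_inv, mul_one]

/-- D is scalar on each of the two diagonal blocks. This is what makes the Maslov form invariant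
under the gauge group. -/
lemma commute_D {g : M3} (hg : g ∈ G0C) : g * D = D * g := by
  obtain ⟨h1, h2, h3, h4, -, -⟩ := G0C_entries hg
  ext i j
  fin_cases i <;> fin_cases j <;> simp [D, Matrix.mul_apply, Fin.sum_univ_three, h1, h2, h3, h4, mul_comm]

/-- The squared length of the first column. -/
def colNormSq (g : M3) : ℝ := Complex.normSq (g 0 0) + Complex.normSq (g 1 0)

/-- The `G₀`-factor in the Iwasawa decomposition of the complexification of `G₀`. -/
def unitaryPart (g : M3) : M3 :=
  !![((√(colNormSq g))⁻¹ : ℝ) * g 0 0, -(((√(colNormSq g))⁻¹ : ℝ) * conj (g 1 0)), 0;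
     ((√(colNormSq g))⁻¹ : ℝ) * g 1 0, ((√(colNormSq g))⁻¹ : ℝ) * conj (g 0 0), 0;
     0, 0, 1]

lemma colNormSq_pos {g : M3} (hg : g ∈ G0C) : 0 < colNormSq g := by
  obtain ⟨-, -, -, -, -, h⟩ := G0C_entries hg
  by_contra hcon
  have h0 := Complex.normSq_nonneg (g 0 0)
  have h1 := Complex.normSq_nonneg (g 1 0)
  rw [colNormSq] at hcon
  have e0 : g 0 0 = 0 := Complex.normSq_eq_zero.1 (by linarith)
  have e1 : g 1 0 = 0 := Complex.normSq_eq_zero.1 (by linarith)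
  simp [e0, e1] at h

lemma sqrt_inv_mul_normSq {g : M3} (hg : g ∈ G0C) :
    (((√(colNormSq g))⁻¹ : ℝ) : ℂ) * ((√(colNormSq g))⁻¹ : ℝ) *
      (g 0 0 * conj (g 0 0) + g 1 0 * conj (g 1 0)) = 1 := by
  have hpos := colNormSq_pos hg
  have : g 0 0 * conj (g 0 0) + g 1 0 * conj (g 1 0) = (colNormSq g : ℂ) := by
    rw [Complex.mul_conj, Complex.mul_conj, colNormSq]; push_cast; ring
  rw [this, ← Complex.ofReal_mul, ← Complex.ofReal_mul, ← mul_inv, Real.mul_self_sqrt hpos.le,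
    inv_mul_cancel₀ hpos.ne', Complex.ofReal_one]

lemma unitaryPart_mem {g : M3} (hg : g ∈ G0C) : unitaryPart g ∈ G0 := by
  have h := sqrt_inv_mul_normSq hg
  refine ⟨mem_G0C_of_block (by linear_combination h), ?_⟩
  ext i j
  fin_cases i <;> fin_cases j <;>
    simp [unitaryPart, Matrix.mul_apply, Fin.sum_univ_three, -ofReal_inv] <;>
    first | ring1 | linear_combination h

/-- Existence half of the Iwasawa decomposition, by Gram–Schmidt: with r the length of the first
column, the triangular factor has diagonal r, r⁻¹, 1. -/
lemma unitaryPart_inv_mul_mem {g : M3} (hg : g ∈ G0C) : (unitaryPart g)⁻¹ * g ∈ B := by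
  have hk := unitaryPart_mem hg
  have h := sqrt_inv_mul_normSq hg
  obtain ⟨h1, h2, h3, h4, h5, h6⟩ := G0C_entries hg
  refine ⟨G0C_mul (G0C_inv hk.1) hg, ?_, ?_⟩
  · rw [G0_inv_eq hk]
    intro i j hij
    fin_cases i <;> fin_cases j <;> first | exact absurd hij (by decide) |
      (simp [unitaryPart, Matrix.mul_apply, Fin.sum_univ_three, -ofReal_inv, h3, h4]; try ring)
  · rw [G0_inv_eq hk]
    have hpos := Real.sqrt_pos.2 (colNormSq_pos hg)
    set r := √(colNormSq g) with hr
    have hrc : ((r : ℝ) : ℂ) * (r⁻¹ : ℝ) = 1 := by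
      rw [← Complex.ofReal_mul, mul_inv_cancel₀ hpos.ne', Complex.ofReal_one]
    intro i
    fin_cases i
    · refine ⟨r, hpos, ?_⟩
      simp [unitaryPart, Matrix.mul_apply, Fin.sum_univ_three, -ofReal_inv, h3]
      rw [← hr]
      linear_combination ((r : ℝ) : ℂ) * h - ((r⁻¹ : ℝ) : ℂ) * (g 0 0 * conj (g 0 0) + g 1 0 * conj (g 1 0)) * hrc
    · refine ⟨r⁻¹, inv_pos.2 hpos, ?_⟩
      simp [unitaryPart, Matrix.mul_apply, Fin.sum_univ_three, -ofReal_inv, h4]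
      rw [← hr]
      linear_combination ((r⁻¹ : ℝ) : ℂ) * h6
    · refine ⟨1, one_pos, ?_⟩
      simp [unitaryPart, Matrix.mul_apply, Fin.sum_univ_three, h5]

lemma B_mul {a b : M3} (ha : a ∈ B) (hb : b ∈ B) : a * b ∈ B := by
  obtain ⟨ha0, ha1, ha2⟩ := ha
  obtain ⟨hb0, hb1, hb2⟩ := hb
  have a10 := ha1 1 0 (by decide)
  have a20 := ha1 2 0 (by decide)
  have a21 := ha1 2 1 (by decide)
  have b10 := hb1 1 0 (by decide)
  have b20 := hb1 2 0 (by decide)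
  have b21 := hb1 2 1 (by decide)
  refine ⟨G0C_mul ha0 hb0, ?_, ?_⟩
  · intro i j hij
    fin_cases i <;> fin_cases j <;> first | exact absurd hij (by decide) |
      simp [Matrix.mul_apply, Fin.sum_univ_three, a10, a20, a21, b10, b20, b21]
  · intro i
    obtain ⟨r, hr, hr'⟩ := ha2 i
    obtain ⟨s, hs, hs'⟩ := hb2 i
    refine ⟨r * s, mul_pos hr hs, ?_⟩
    rw [Complex.ofReal_mul, ← hr', ← hs']
    fin_cases i <;> simp [Matrix.mul_apply, Fin.sum_univ_three, a10, a20, a21, b10, b20, b21]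

lemma B_inv {b : M3} (hb : b ∈ B) : b⁻¹ ∈ B := by
  obtain ⟨hb0, hb1, hb2⟩ := hb
  obtain ⟨h1, h2, h3, h4, h5, h6⟩ := G0C_entries hb0
  have b10 := hb1 1 0 (by decide)
  have hinv : b⁻¹ = !![b 1 1, -b 0 1, 0; 0, b 0 0, 0; 0, 0, 1] := by
    refine Matrix.inv_eq_right_inv ?_
    rw [b10] at h6
    ext i j
    fin_cases i <;> fin_cases j <;>
      simp [Matrix.mul_apply, Fin.sum_univ_three, h1, h2, h3, h4, h5, b10] <;>
      first | ring1 | linear_combination h6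
  refine ⟨G0C_inv hb0, ?_, ?_⟩
  · rw [hinv]
    intro i j hij
    fin_cases i <;> fin_cases j <;> first | exact absurd hij (by decide) | simp
  · rw [hinv]
    intro i
    fin_cases i
    · exact hb2 1
    · exact hb2 0
    · exact ⟨1, one_pos, by simp⟩

/-- Uniqueness half of the Iwasawa decomposition. The first column has length r, so r = 1;
orthogonality of the first two columns kills the entry above the diagonal, and the block determinant
fixes the rest. -/
lemma eq_one_of_mem_B_of_unitary {b : M3} (hb : b ∈ B) (hu : bᴴ * b = 1) : b = 1 := by
  obtain ⟨hb0, hb1, hb2⟩ := hb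
  obtain ⟨h1, h2, h3, h4, h5, h6⟩ := G0C_entries hb0
  have b10 := hb1 1 0 (by decide)
  obtain ⟨r, hr, hr'⟩ := hb2 0
  have e00 := congrFun (congrFun hu 0) 0
  have e01 := congrFun (congrFun hu 0) 1
  simp [Matrix.mul_apply, Fin.sum_univ_three, b10, h3, h4, hr'] at e00 e01
  have hr1 : r = 1 := by
    have : r * r = 1 := by exact_mod_cast e00
    nlinarith
  have h01 : b 0 1 = 0 := by
    rcases e01 with h | h
    · exact absurd h hr.ne'
    · exact h
  rw [hr', hr1, b10] at h6
  have h11 : b 1 1 = 1 := by simpa using h6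
  ext i j
  fin_cases i <;> fin_cases j <;> simp [h1, h2, h3, h4, h5, b10, h01, h11, hr', hr1]

/-! ### Twisted loop groups -/

lemma loopGroup_mul {Δ : Set (OnePoint ℂ)} {g h : Loop} (hg : g ∈ loopGroup Δ)
    (hh : h ∈ loopGroup Δ) : (fun ζ => g ζ * h ζ) ∈ loopGroup Δ := by
  refine ⟨?_, fun ζ hζ => ?_⟩
  · rw [analyticOnSphere_iff]
    exact fun p hp => ((analyticOnSphere_iff _ _).1 hg.1 p hp).mul
      ((analyticOnSphere_iff _ _).1 hh.1 p hp)
  · obtain ⟨a1, a2, a3⟩ := hg.2 ζ hζ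
    obtain ⟨b1, b2, b3⟩ := hh.2 ζ hζ
    exact ⟨by rw [det_mul, a1, b1, one_mul], by rw [conjGrp_mul, a2, b2],
      by rw [tauGrp_mul, a3, b3]⟩

lemma loopGroup_inv {Δ : Set (OnePoint ℂ)} {g : Loop} (hg : g ∈ loopGroup Δ) :
    (fun ζ => (g ζ)⁻¹) ∈ loopGroup Δ := by
  refine ⟨?_, fun ζ hζ => ?_⟩
  · rw [analyticOnSphere_iff]
    exact fun p hp => ((analyticOnSphere_iff _ _).1 hg.1 p hp).inv
      (by rw [chart_chartPt]; exact (hg.2 p hp).1)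
  · obtain ⟨a1, a2, a3⟩ := hg.2 ζ hζ
    exact ⟨det_inv_eq_one a1, by rw [conjGrp_inv a1, a2], by rw [tauGrp_inv a1, a3]⟩

lemma const_mem_loopGroup (Δ : Set (OnePoint ℂ)) {k : M3} (hk : k ∈ G0) :
    (fun _ => k) ∈ loopGroup Δ := by
  refine ⟨?_, fun ζ _ => ⟨hk.1.1, conjGrp_of_mem_G0 hk, hk.1.2⟩⟩
  rw [analyticOnSphere_iff]
  exact fun p _ => entryAnalyticAt_const k _

lemma loopGroup_mono {Δ Δ' : Set (OnePoint ℂ)} (h : Δ ⊆ Δ') : loopGroup Δ' ⊆ loopGroup Δ :=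
  fun _ hg => ⟨hg.1.mono h, fun ζ hζ => hg.2 ζ (h hζ)⟩

/-- Uniqueness of the first factor. -/
lemma IsEFactor.eqOn {ε : ℝ} (hε0 : 0 < ε) (hε1 : ε < 1) {g a b : Loop}
    (ha : IsEFactor ε g a) (hb : IsEFactor ε g b) : Set.EqOn a b (annulus ε) := by
  have hεi := one_lt_inv_iff₀.2 ⟨hε0, hε1⟩
  obtain ⟨haE, aI, haI, hga⟩ := ha
  obtain ⟨hbE, bI, hbI, hgb⟩ := hb
  have hf := loopGroup_mul (loopGroup_inv haE) hbE
  have hh := loopGroup_mul haI.1 (loopGroup_inv hbI.1)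
  have hcirc : ∀ p ∈ circles ε, (a p)⁻¹ * b p = aI p * (bI p)⁻¹ := by
    intro p hp
    have h1 := hga p hp
    rw [hgb p hp] at h1
    have ua := isUnit_det_of_det_eq_one (haE.2 p (circles_subset_annulus hε0 hε1 hp)).1
    have ub := isUnit_det_of_det_eq_one (hbI.1.2 p (circles_subset_discs hp)).1
    calc (a p)⁻¹ * b p = (a p)⁻¹ * (b p * bI p) * (bI p)⁻¹ := by
          rw [mul_assoc, mul_assoc, Matrix.mul_nonsing_inv _ ub, mul_one]
      _ = aI p * (bI p)⁻¹ := by rw [h1, ← mul_assoc, Matrix.nonsing_inv_mul _ ua, one_mul]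
  have hc : ∀ i j : Fin 3, ∃ c : ℂ, (∀ p ∈ annulus ε, ((a p)⁻¹ * b p) i j = c) ∧
      ∀ p ∈ discs ε, (aI p * (bI p)⁻¹) i j = c := fun i j =>
    exists_const_of_eqOn_circles hε0 hε1 (fun p hp => hf.1 p hp i j) (fun p hp => hh.1 p hp i j)
      (fun p hp => by simp only [hcirc p hp])
  choose c hc1 hc2 using hc
  have hC1 : ∀ p ∈ annulus ε, (a p)⁻¹ * b p = Matrix.of c := fun p hp => by
    ext i j; exact hc1 i j p hp
  have hC2 : ∀ p ∈ discs ε, aI p * (bI p)⁻¹ = Matrix.of c := fun p hp => by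
    ext i j; exact hc2 i j p hp
  -- The constant is read off at two points: at ζ = 0 it lies in B, and at ζ = 1, a fixed point of
  -- the real involution, it is unitary.
  have hB : Matrix.of c ∈ B := by
    rw [← hC2 ((0 : ℂ) : OnePoint ℂ) (coe_mem_discs.2 (Or.inl (by simpa using hε0.le)))]
    exact B_mul haI.2 (B_inv hbI.2)
  have h1m : ((1 : ℂ) : OnePoint ℂ) ∈ annulus ε :=
    coe_mem_annulus.2 ⟨by simpa using hε1.le, by simpa using hεi.le⟩
  have hone : Matrix.of c = 1 := by
    refine eq_one_of_mem_B_of_unitary hB ?_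
    have := (hf.2 _ h1m).2.1
    rw [realInv_coe one_ne_zero, map_one, inv_one] at this
    beta_reduce at this
    rw [hC1 _ h1m, conjGrp] at this
    nth_rewrite 2 [← this]
    exact Matrix.mul_nonsing_inv _ (by simp [det_conjTranspose, hB.1.1])
  intro p hp
  have h1 := hC1 p hp
  rw [hone] at h1
  have ua := isUnit_det_of_det_eq_one (haE.2 p hp).1
  calc a p = a p * ((a p)⁻¹ * b p) := by rw [h1, mul_one]
    _ = b p := by rw [← mul_assoc, Matrix.mul_nonsing_inv _ ua, one_mul]

/-! ### Extension of loops by the real symmetry -/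

/-- The extension to the outside of the unit disc of a map on the unit disc by means of a real
structure `σ`. -/
def reflectExtend (σ : M3 → M3) (H : ℂ → M3) : Loop
  | .infty => σ (H 0)
  | .some ζ => if ‖ζ‖ < 1 then H ζ else σ (H (conj ζ)⁻¹)

lemma reflectExtend_of_lt (σ : M3 → M3) (H : ℂ → M3) {ζ : ℂ} (h : ‖ζ‖ < 1) :
    reflectExtend σ H (ζ : OnePoint ℂ) = H ζ := if_pos h

lemma reflectExtend_of_gt (σ : M3 → M3) (H : ℂ → M3) {ζ : ℂ} (h : 1 < ‖ζ‖) :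
    reflectExtend σ H (ζ : OnePoint ℂ) = σ (H (conj ζ)⁻¹) := if_neg h.not_gt

lemma reflectExtend_infty (σ : M3 → M3) (H : ℂ → M3) :
    reflectExtend σ H OnePoint.infty = σ (H 0) := rfl

lemma norm_conj_inv (ζ : ℂ) : ‖(conj ζ)⁻¹‖ = ‖ζ‖⁻¹ := by simp

lemma norm_conj_inv_lt_one {ζ : ℂ} (h : 1 < ‖ζ‖) : ‖(conj ζ)⁻¹‖ < 1 := by
  rw [norm_conj_inv]; exact inv_lt_one_of_one_lt₀ h

lemma one_lt_norm_conj_inv {ζ : ℂ} (h0 : ζ ≠ 0) (h : ‖ζ‖ < 1) : 1 < ‖(conj ζ)⁻¹‖ := by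
  rw [norm_conj_inv]; exact (one_lt_inv₀ (norm_pos_iff.2 h0)).2 h

/-- In the chart w = 1/ζ the outer half is w ↦ σ(H(conj w)), so `hσ` is exactly holomorphy there.
The unit circle, where the two halves may jump, is disjoint from `discs ε`. -/
lemma reflectExtend_analytic {σ : M3 → M3} {H : ℂ → M3}
    (hH : ∀ w : ℂ, ‖w‖ < 1 → EntryAnalyticAt H w)
    (hσ : ∀ w : ℂ, ‖w‖ < 1 → EntryAnalyticAt (fun v => σ (H (conj v))) w)
    {ε : ℝ} (hε0 : 0 < ε) (hε1 : ε < 1) : AnalyticOnSphere (discs ε) (reflectExtend σ H) := by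
  have hεi := one_lt_inv_iff₀.2 ⟨hε0, hε1⟩
  rw [analyticOnSphere_iff]
  intro p hp
  induction p using OnePoint.rec with
  | infty =>
    refine (hσ 0 (by simp)).congr ?_
    filter_upwards [eventually_norm_lt (w := 0) (r := 1) (by simp)] with w hw
    change _ = reflectExtend σ H (sphereInv w)
    by_cases h0 : w = 0
    · subst h0; rw [sphereInv_zero, reflectExtend_infty, map_zero]
    · rw [sphereInv_coe h0, reflectExtend_of_gt]
      · simp
      · rw [norm_inv]; exact (one_lt_inv₀ (norm_pos_iff.2 h0)).2 hw
  | coe ζ =>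
    change EntryAnalyticAt (fun w : ℂ => reflectExtend σ H (w : OnePoint ℂ)) ζ
    rcases coe_mem_discs.1 hp with h | h
    · have h1 : ‖ζ‖ < 1 := by linarith
      refine (hH ζ h1).congr ?_
      filter_upwards [eventually_norm_lt h1] with w hw
      rw [reflectExtend_of_lt _ _ hw]
    · have h1 : 1 < ‖ζ‖ := by linarith
      have h0 : ζ ≠ 0 := norm_pos_iff.1 (by linarith)
      refine ((hσ ζ⁻¹ (by rw [norm_inv]; exact inv_lt_one_of_one_lt₀ h1)).comp
        (f := fun w => w⁻¹) (analyticAt_inv h0)).congr ?_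
      filter_upwards [eventually_lt_norm h1] with w hw
      rw [reflectExtend_of_gt _ _ hw, map_inv₀]

lemma conj_I_mul_inv (ζ : ℂ) : (conj (I * ζ))⁻¹ = I * (conj ζ)⁻¹ := by
  rw [map_mul, conj_I, mul_inv, inv_neg, inv_I, neg_neg]

lemma norm_I_mul (ζ : ℂ) : ‖I * ζ‖ = ‖ζ‖ := by simp

/-- The extension by reflection of a twisted map on the unit disc is a twisted loop on `I_ε`. -/
lemma reflectExtend_mem_loopGroupB {H : ℂ → M3}
    (hH : ∀ w : ℂ, ‖w‖ < 1 → EntryAnalyticAt H w) (hd : ∀ w : ℂ, ‖w‖ < 1 → (H w).det = 1)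
    (hτ : ∀ w : ℂ, ‖w‖ < 1 → tauGrp (H w) = H (I * w)) (hB : H 0 ∈ B)
    {ε : ℝ} (hε0 : 0 < ε) (hε1 : ε < 1) : reflectExtend conjGrp H ∈ loopGroupB ε := by
  have hεi := one_lt_inv_iff₀.2 ⟨hε0, hε1⟩
  have h0' : ‖(0 : ℂ)‖ < 1 := by simp
  refine ⟨⟨reflectExtend_analytic hH (fun w hw => ?_) hε0 hε1, fun p hp => ?_⟩, ?_⟩
  · have hw' : ‖conj w‖ < 1 := by simpa using hw
    exact (hH _ hw').conjGrp_conj (hd _ hw')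
  · induction p using OnePoint.rec with
    | infty =>
      rw [reflectExtend_infty, realInv_infty, rotI_infty, reflectExtend_infty,
        reflectExtend_of_lt _ _ h0', conjGrp_conjGrp (hd 0 h0'), tauGrp_conjGrp, hτ 0 h0', mul_zero]
      exact ⟨det_conjGrp (hd 0 h0'), rfl, rfl⟩
    | coe ζ =>
      rcases coe_mem_discs.1 hp with h | h
      · have h1 : ‖ζ‖ < 1 := by linarith
        rw [reflectExtend_of_lt _ _ h1, rotI_coe, reflectExtend_of_lt _ _ (by rwa [norm_I_mul])]
        refine ⟨hd ζ h1, ?_, hτ ζ h1⟩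
        by_cases h0 : ζ = 0
        · subst h0; rw [realInv_zero, reflectExtend_infty]
        · rw [realInv_coe h0, reflectExtend_of_gt _ _ (one_lt_norm_conj_inv h0 h1)]
          simp
      · have h1 : 1 < ‖ζ‖ := by linarith
        have h0 : ζ ≠ 0 := norm_pos_iff.1 (by linarith)
        have h2 := norm_conj_inv_lt_one h1
        rw [reflectExtend_of_gt _ _ h1, rotI_coe, realInv_coe h0, reflectExtend_of_lt _ _ h2,
          reflectExtend_of_gt _ _ (by rwa [norm_I_mul]), conj_I_mul_inv]
        exact ⟨det_conjGrp (hd _ h2), conjGrp_conjGrp (hd _ h2), by rw [tauGrp_conjGrp, hτ _ h2]⟩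
  · rwa [reflectExtend_of_lt _ _ h0']

/-- A factorisation on the circle of radius `ε` extends to `C_ε` by the real symmetry. -/
lemma isEFactor_of_eq_on_inner {ε : ℝ} (hε0 : 0 < ε) (hε1 : ε < 1) {g gE : Loop}
    (hg : ∀ ζ : ℂ, ‖ζ‖ = ε → conjGrp (g (ζ : OnePoint ℂ)) = g (realInv ζ))
    (hE : gE ∈ loopGroup punctured) {H : ℂ → M3}
    (hH : ∀ w : ℂ, ‖w‖ < 1 → EntryAnalyticAt H w) (hd : ∀ w : ℂ, ‖w‖ < 1 → (H w).det = 1)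
    (hτ : ∀ w : ℂ, ‖w‖ < 1 → tauGrp (H w) = H (I * w)) (hB : H 0 ∈ B)
    (heq : ∀ ζ : ℂ, ‖ζ‖ = ε → g (ζ : OnePoint ℂ) = gE (ζ : OnePoint ℂ) * H ζ) :
    IsEFactor ε g gE := by
  have hεi := one_lt_inv_iff₀.2 ⟨hε0, hε1⟩
  refine ⟨loopGroup_mono (annulus_subset_punctured hε0) hE, _,
    reflectExtend_mem_loopGroupB hH hd hτ hB hε0 hε1, fun p hp => ?_⟩
  obtain ⟨ζ, rfl, h | h⟩ := mem_circles hp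
  · rw [heq ζ h, reflectExtend_of_lt _ _ (by linarith)]
  · have h1 : 1 < ‖ζ‖ := by linarith
    have h0 : ζ ≠ 0 := norm_pos_iff.1 (by linarith)
    -- The mirror image of ζ lies on the inner circle; conjugating the factorisation there gives the
    -- one at ζ.
    set w := (conj ζ)⁻¹ with hw
    have hw0 : w ≠ 0 := inv_ne_zero (by simpa using h0)
    have hwε : ‖w‖ = ε := by rw [hw, norm_conj_inv, h, inv_inv]
    have hζ : realInv (w : OnePoint ℂ) = (ζ : OnePoint ℂ) := by
      rw [realInv_coe hw0, hw]; simp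
    rw [reflectExtend_of_gt _ _ h1, ← hζ, ← hg w hwε, heq w hwε, conjGrp_mul,
      (hE.2 w (coe_mem_punctured.2 hw0)).2.1, ← hw]

/-! ### Multiplication of loops by scalar functions -/

lemma innerMul_of_lt (f : ℂ → ℂ) (ξ : Loop) {ζ : ℂ} (h : ‖ζ‖ < 1) :
    innerMul f ξ (ζ : OnePoint ℂ) = f ζ • ξ (ζ : OnePoint ℂ) := by
  change (if ‖ζ‖ < 1 then f ζ else conj (f (conj ζ)⁻¹)) • _ = _
  rw [if_pos h]

lemma innerMul_of_gt (f : ℂ → ℂ) (ξ : Loop) {ζ : ℂ} (h : 1 < ‖ζ‖) :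
    innerMul f ξ (ζ : OnePoint ℂ) = conj (f (conj ζ)⁻¹) • ξ (ζ : OnePoint ℂ) := by
  change (if ‖ζ‖ < 1 then f ζ else conj (f (conj ζ)⁻¹)) • _ = _
  rw [if_neg h.not_gt]

lemma conjAlg_innerMul (f : ℂ → ℂ) (ξ : Loop) {ζ : ℂ} (h0 : ζ ≠ 0) (h1 : ‖ζ‖ ≠ 1)
    (hξ : conjAlg (ξ (ζ : OnePoint ℂ)) = ξ (realInv ζ)) :
    conjAlg (innerMul f ξ (ζ : OnePoint ℂ)) = innerMul f ξ (realInv ζ) := by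
  rw [realInv_coe h0] at *
  rcases lt_or_gt_of_ne h1 with h | h
  · rw [innerMul_of_lt _ _ h, innerMul_of_gt _ _ (one_lt_norm_conj_inv h0 h), conjAlg_smul, hξ]
    simp
  · rw [innerMul_of_gt _ _ h, innerMul_of_lt _ _ (norm_conj_inv_lt_one h), conjAlg_smul, hξ]
    simp

lemma conjGrp_exp (X : M3) : conjGrp (NormedSpace.exp X) = NormedSpace.exp (conjAlg X) := by
  rw [conjGrp, conjAlg, ← Matrix.exp_conjTranspose, ← Matrix.exp_neg]

lemma tauGrp_exp (X : M3) : tauGrp (NormedSpace.exp X) = NormedSpace.exp (tauAlg X) := by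
  have hS : IsUnit S := (Matrix.isUnit_iff_isUnit_det S).2 (Matrix.isUnit_det_of_right_inverse S_mul_inv)
  rw [tauGrp, ← Matrix.exp_transpose, ← Matrix.exp_neg, ← Matrix.exp_conj _ _ hS, tauAlg]
  simp

/-- The exponent is a multiple of 4, so multiplication by ζ^{4d} respects the twist: i^{4d} = 1. It
also raises the lowest power of ζ from −4d−2 to −2. -/
lemma symesDatum_mem_loopAlgebraM2 {ε : ℝ} (hε0 : 0 < ε) (hε1 : ε < 1) {d : ℕ} {ξ : ℂ → Loop}
    (hξ : ξ 0 ∈ loopAlgebra punctured) {c : ℤ → M3}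
    (hc : ∀ ζ : ℂ, ζ ≠ 0 → ξ 0 (ζ : OnePoint ℂ) =
      ∑ j ∈ Finset.Icc (-(4 * (d : ℤ) + 2)) (4 * (d : ℤ) + 2), ζ ^ j • c j) :
    symesDatum d ξ ∈ loopAlgebraM2 ε := by
  have hεi := one_lt_inv_iff₀.2 ⟨hε0, hε1⟩
  have hcase : ∀ ζ : ℂ, (‖ζ‖ = ε ∨ ‖ζ‖ = ε⁻¹) → ζ ≠ 0 ∧ (‖ζ‖ < 1 ∨ 1 < ‖ζ‖) := by
    rintro ζ (h | h)
    · exact ⟨norm_pos_iff.1 (by linarith), Or.inl (by linarith)⟩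
    · exact ⟨norm_pos_iff.1 (by linarith), Or.inr (by linarith)⟩
  refine ⟨⟨?_, fun p hp => ?_⟩, ?_⟩
  · rw [analyticOnSphere_iff]
    intro p hp
    obtain ⟨ζ, rfl, h⟩ := mem_circles hp
    obtain ⟨h0, h1⟩ := hcase ζ h
    have hξa : EntryAnalyticAt (fun w : ℂ => ξ 0 (w : OnePoint ℂ)) ζ :=
      hξ.1.entryAnalyticAt (coe_mem_punctured.2 h0)
    change EntryAnalyticAt (fun w : ℂ => innerMul _ _ (w : OnePoint ℂ)) ζ
    rcases h1 with h1 | h1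
    · refine (EntryAnalyticAt.smul (f := fun w => w ^ (4 * d)) (by fun_prop) hξa).congr ?_
      filter_upwards [eventually_norm_lt h1] with w hw
      rw [innerMul_of_lt _ _ hw]
    · refine (EntryAnalyticAt.smul (f := fun w => (w⁻¹) ^ (4 * d))
        ((analyticAt_inv h0).pow _) hξa).congr ?_
      filter_upwards [eventually_lt_norm h1] with w hw
      rw [innerMul_of_gt _ _ hw]
      simp
  · obtain ⟨ζ, rfl, h⟩ := mem_circles hp
    obtain ⟨h0, h1⟩ := hcase ζ h
    obtain ⟨b1, b2, b3⟩ := hξ.2 ζ (coe_mem_punctured.2 h0)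
    refine ⟨?_, conjAlg_innerMul _ _ h0 (by rcases h1 with h1 | h1 <;> [exact h1.ne; exact h1.ne'])
      b2, ?_⟩
    · rcases h1 with h1 | h1
      · rw [symesDatum, innerMul_of_lt _ _ h1, trace_smul, b1, smul_zero]
      · rw [symesDatum, innerMul_of_gt _ _ h1, trace_smul, b1, smul_zero]
    · have hI : I ^ (4 * d) = 1 := by rw [pow_mul, I_pow_four, one_pow]
      rw [rotI_coe] at *
      rcases h1 with h1 | h1
      · rw [symesDatum, innerMul_of_lt _ _ h1, innerMul_of_lt _ _ (by rwa [norm_I_mul]), tauAlg_smul,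
          b3, mul_pow, hI, one_mul]
      · rw [symesDatum, innerMul_of_gt _ _ h1, innerMul_of_gt _ _ (by rwa [norm_I_mul]), tauAlg_smul,
          b3, conj_I_mul_inv, mul_pow, hI, one_mul]
  -- P is ζ^{4d+2} ξ(0) written with natural exponents, so that it makes sense and is holomorphic at
  -- ζ = 0; its reflection is the required extension.
  · set P : ℂ → M3 := fun ζ => ∑ j ∈ Finset.Icc (-(4 * (d : ℤ) + 2)) (4 * (d : ℤ) + 2),
      ζ ^ (j + (4 * d + 2)).toNat • c j with hP
    have hPa : ∀ w, EntryAnalyticAt P w := by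
      intro w i j
      simp only [hP, Matrix.sum_apply, Matrix.smul_apply, smul_eq_mul]
      exact Finset.analyticAt_fun_sum _ fun k _ => by fun_prop
    have hPe : ∀ ζ : ℂ, ζ ≠ 0 → P ζ = ζ ^ 2 • ζ ^ (4 * d) • ξ 0 (ζ : OnePoint ℂ) := by
      intro ζ h0
      rw [hc ζ h0, hP, smul_smul, Finset.smul_sum]
      refine Finset.sum_congr rfl fun j hj => ?_
      rw [Finset.mem_Icc] at hj
      rw [smul_smul]
      congr 1
      rw [← zpow_natCast, Int.toNat_of_nonneg (by lia), zpow_add₀ h0, mul_comm, ← pow_add,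
        ← zpow_natCast]
      congr 2
      push_cast; ring
    refine ⟨reflectExtend conjAlg P, reflectExtend_analytic (fun w _ => hPa w)
      (fun w _ => (hPa _).conjAlg_conj) hε0 hε1, fun p hp => ?_⟩
    obtain ⟨ζ, rfl, h⟩ := mem_circles hp
    obtain ⟨h0, h1⟩ := hcase ζ h
    rcases h1 with h1 | h1
    · rw [reflectExtend_of_lt _ _ h1, hPe ζ h0, innerMul_of_lt _ _ h1, symesDatum,
        innerMul_of_lt _ _ h1]
    · have hw0 : (conj ζ)⁻¹ ≠ 0 := inv_ne_zero (by simpa using h0)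
      have b2 := (hξ.2 _ (coe_mem_punctured.2 hw0)).2.1
      rw [realInv_coe hw0] at b2
      rw [reflectExtend_of_gt _ _ h1, hPe _ hw0, innerMul_of_gt _ _ h1, symesDatum,
        innerMul_of_gt _ _ h1, conjAlg_smul, conjAlg_smul, b2]
      simp

/-! ### Calculus of matrix valued functions -/

attribute [local instance] Matrix.linftyOpNormedRing Matrix.linftyOpNormedAlgebra

/-- Matrices as an iterated function space, as a continuous linear equivalence. -/
def matCLE : (Fin 3 → Fin 3 → ℂ) ≃L[ℝ] M3 :=
  LinearEquiv.toContinuousLinearEquiv (Matrix.ofLinearEquiv ℝ)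

/-- Smoothness as an abbreviation for `C^∞` over `ℝ`. -/
abbrev smoothExp : WithTop ℕ∞ := ((⊤ : ℕ∞) : WithTop ℕ∞)

lemma contDiffOn_mat_iff {E : Type*} [NormedAddCommGroup E] [NormedSpace ℝ E] {f : E → M3}
    {s : Set E} {n : WithTop ℕ∞} :
    ContDiffOn ℝ n f s ↔ ∀ i j, ContDiffOn ℝ n (fun x => f x i j) s := by
  have h1 : ContDiffOn ℝ n f s ↔ ContDiffOn ℝ n (fun x => matCLE.symm (f x)) s :=
    (matCLE.symm.comp_contDiffOn_iff (f := f) (s := s) (n := n)).symm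
  rw [h1, contDiffOn_pi]
  simp only [contDiffOn_pi]
  rfl

lemma contDiff_mat_iff {E : Type*} [NormedAddCommGroup E] [NormedSpace ℝ E] {f : E → M3}
    {n : WithTop ℕ∞} : ContDiff ℝ n f ↔ ∀ i j, ContDiff ℝ n (fun x => f x i j) := by
  simp only [← contDiffOn_univ]
  exact contDiffOn_mat_iff

lemma smoothMat_iff {f : ℂ → M3} : SmoothMat f ↔ ContDiff ℝ smoothExp f := contDiff_mat_iff.symm

lemma hasDerivAt_mat_iff {f : ℝ → M3} {f' : M3} {t : ℝ} :
    HasDerivAt f f' t ↔ ∀ i j, HasDerivAt (fun s => f s i j) (f' i j) t := by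
  constructor
  · exact fun h i j => hasDerivAt_pi.1 (hasDerivAt_pi.1 h i) j
  · intro h
    exact matCLE.toContinuousLinearMap.hasFDerivAt.comp_hasDerivAt t
      (hasDerivAt_pi.2 fun i => hasDerivAt_pi.2 (h i))

lemma contDiffOn_mat_inv {E : Type*} [NormedAddCommGroup E] [NormedSpace ℝ E] {f : E → M3}
    {s : Set E} {n : WithTop ℕ∞} (hf : ContDiffOn ℝ n f s) (hd : ∀ x ∈ s, (f x).det = 1) :
    ContDiffOn ℝ n (fun x => (f x)⁻¹) s := by
  intro x hx
  simp only [Matrix.nonsing_inv_eq_ringInverse]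
  have hu : IsUnit (f x) := (Matrix.isUnit_iff_isUnit_det _).2 (isUnit_det_of_det_eq_one (hd x hx))
  obtain ⟨u, hu⟩ := hu
  exact ContDiffAt.comp_contDiffWithinAt x (hu ▸ contDiffAt_ringInverse ℝ u) (hf x hx)

lemma hasDerivAt_mat_inv {u : ℝ → M3} {a : M3} {t : ℝ} (hu : HasDerivAt u (u t * a) t)
    (hd : (u t).det = 1) : HasDerivAt (fun s => (u s)⁻¹) (-(a * (u t)⁻¹)) t := by
  have hdu := isUnit_det_of_det_eq_one hd
  obtain ⟨v, hv⟩ := (Matrix.isUnit_iff_isUnit_det _).2 hdu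
  have h1 := hasFDerivAt_ringInverse (𝕜 := ℝ) v
  rw [hv] at h1
  have h2 := h1.comp_hasDerivAt t hu
  simp only [Matrix.nonsing_inv_eq_ringInverse]
  have h3 : ((v⁻¹ : M3ˣ) : M3) = (u t)⁻¹ := by rw [← hv, Matrix.coe_units_inv]
  refine h2.congr_deriv ?_
  rw [← Matrix.nonsing_inv_eq_ringInverse]
  simp only [h3, _root_.neg_apply, ContinuousLinearMap.mulLeftRight_apply]
  rw [← mul_assoc (u t)⁻¹, Matrix.nonsing_inv_mul _ hdu, one_mul]

/-- The derivative of a matrix valued function along a ray. -/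
lemma hasDerivAt_ray {f : ℂ → M3} (hf : SmoothMat f) (z : ℂ) (t : ℝ) :
    HasDerivAt (fun s : ℝ => f (s * z)) (dMat f (t * z) z) t := by
  rw [hasDerivAt_mat_iff]
  intro i j
  have h1 : HasDerivAt (fun s : ℝ => (s : ℂ) * z) z t := by
    simpa using (Complex.ofRealCLM.hasDerivAt (x := t)).mul_const z
  have h2 : DifferentiableAt ℝ (fun w => f w i j) (t * z) :=
    ((hf i j).differentiable (by simp)) _
  exact h2.hasFDerivAt.comp_hasDerivAt t h1

/-- Liouville's formula for the determinant of a solution of a linear equation. -/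
lemma hasDerivAt_det {E : ℝ → M3} {X : M3} {t : ℝ} (h : HasDerivAt E (X * E t) t) :
    HasDerivAt (fun s => (E s).det) (X.trace * (E t).det) t := by
  have he := hasDerivAt_mat_iff.1 h
  simp only [Matrix.det_fin_three]
  refine ((((((((he 0 0).fun_mul (he 1 1)).fun_mul (he 2 2)).fun_sub
    (((he 0 0).fun_mul (he 1 2)).fun_mul (he 2 1))).fun_sub
    (((he 0 1).fun_mul (he 1 0)).fun_mul (he 2 2))).fun_add
    (((he 0 1).fun_mul (he 1 2)).fun_mul (he 2 0))).fun_add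
    (((he 0 2).fun_mul (he 1 0)).fun_mul (he 2 1))).fun_sub
    (((he 0 2).fun_mul (he 1 1)).fun_mul (he 2 0))).congr_deriv ?_
  simp only [Matrix.mul_apply, Fin.sum_univ_three, Matrix.trace_fin_three]
  ring

/-- Determinant of the exponential of a trace free matrix. -/
lemma det_exp_eq_one {X : M3} (h : X.trace = 0) : (NormedSpace.exp X).det = 1 := by
  have hd : ∀ t : ℝ, HasDerivAt (fun s : ℝ => (NormedSpace.exp (s • X)).det) 0 t := fun t =>
    (hasDerivAt_det (hasDerivAt_exp_smul_const' X t)).congr_deriv (by rw [h, zero_mul])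
  have hc := is_const_of_deriv_eq_zero (fun t => (hd t).differentiableAt) (fun t => (hd t).deriv) 1 0
  simpa using hc

/-! ### Smooth dependence of integrals on parameters -/

/-- The integral is the value at 0 of the convolution of the indicator of (0, b] with s ↦ f(z, −s),
and convolutions depend smoothly on parameters once the smooth factor is cut off to compact support.
-/
lemma contDiff_parametric_integral {f : ℂ × ℝ → ℂ} (hf : ContDiff ℝ smoothExp f) {b : ℝ}
    (hb : 0 ≤ b) : ContDiff ℝ smoothExp (fun z => ∫ t in (0 : ℝ)..b, f (z, t)) := by
  -- The cutoff equals 1 on [−b−1, b+1], which contains every −t with t in (0, b], so it does not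
  -- change the integral.
  let χ : ContDiffBump (0 : ℝ) := ⟨b + 1, b + 2, by linarith, by linarith⟩
  let φ : ℝ → ℝ := Set.indicator (Set.Ioc 0 b) 1
  let g : ℂ → ℝ → ℂ := fun z s => χ s • f (z, -s)
  have hφ : MeasureTheory.LocallyIntegrable φ MeasureTheory.volume :=
    ((MeasureTheory.integrable_indicator_iff measurableSet_Ioc).2
      (MeasureTheory.integrableOn_const (C := (1 : ℝ)) (by simp))).locallyIntegrable
  have hg : ContDiffOn ℝ smoothExp (Function.uncurry g) (Set.univ ×ˢ Set.univ) := by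
    refine ContDiff.contDiffOn ?_
    change ContDiff ℝ smoothExp fun p : ℂ × ℝ => χ p.2 • f (p.1, -p.2)
    exact (χ.contDiff.comp contDiff_snd).smul (hf.comp (contDiff_fst.prodMk contDiff_snd.neg))
  have := MeasureTheory.contDiffOn_convolution_right_with_param_comp (n := ⊤) (ContinuousLinearMap.lsmul ℝ ℝ)
    (v := fun _ : ℂ => (0 : ℝ)) contDiffOn_const isOpen_univ
    (isCompact_closedBall (0 : ℝ) (b + 2)) (g := g) (fun z s _ hs => ?_) hφ hg
  · rw [contDiffOn_univ] at this
    refine (congrArg (ContDiff ℝ smoothExp) (funext fun z => ?_)).mp this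
    symm
    rw [MeasureTheory.convolution_def, intervalIntegral.integral_of_le hb,
      ← MeasureTheory.integral_indicator measurableSet_Ioc]
    refine MeasureTheory.integral_congr_ae (Filter.Eventually.of_forall fun t => ?_)
    by_cases ht : t ∈ Set.Ioc 0 b
    · have hχ : χ (-t) = 1 := χ.one_of_mem_closedBall (by
        simp only [Metric.mem_closedBall, dist_zero_right, norm_neg, Real.norm_eq_abs, abs_of_pos ht.1]
        change t ≤ b + 1
        linarith [ht.2])
      simp [φ, g, ht, hχ]
    · simp [φ, ht]
  · have : χ s = 0 := χ.zero_of_le_dist (by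
      simp only [Metric.mem_closedBall, not_le] at hs
      exact hs.le)
    simp [g, this]

/-! ### Extended frames and Killing fields along rays -/

section Frames

variable {μ : ℂ →ₗ[ℝ] ℝ} {F : ℂ → Loop} {α : ℤ → OneForm} {d : ℕ} {ξ : ℂ → Loop}

lemma IsExtendedFrame.det_eq_one (hF : IsExtendedFrame μ F α) (z : ℂ) {ζ : ℂ} (hζ : ζ ≠ 0) :
    (F z (ζ : OnePoint ℂ)).det = 1 :=
  ((hF.loop z).2 ζ (coe_mem_punctured.2 hζ)).1

lemma IsExtendedFrame.contDiffOn (hF : IsExtendedFrame μ F α) :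
    ContDiffOn ℝ smoothExp (fun p : ℂ × ℂ => F p.1 (p.2 : OnePoint ℂ)) {p | p.2 ≠ 0} :=
  contDiffOn_mat_iff.2 hF.smooth

lemma IsExtendedFrame.smoothMat (hF : IsExtendedFrame μ F α) {ζ : ℂ} (hζ : ζ ≠ 0) :
    SmoothMat (fun z => F z (ζ : OnePoint ℂ)) := by
  rw [smoothMat_iff, ← contDiffOn_univ]
  exact hF.contDiffOn.comp (g := fun p : ℂ × ℂ => F p.1 (p.2 : OnePoint ℂ))
    (f := fun z => (z, ζ)) (contDiff_id.prodMk contDiff_const).contDiffOn (fun _ _ => hζ)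

lemma IsExtendedFrame.dMat_eq (hF : IsExtendedFrame μ F α) {ζ : ℂ} (hζ : ζ ≠ 0) (z v : ℂ) :
    dMat (fun w => F w (ζ : OnePoint ℂ)) z v = F z (ζ : OnePoint ℂ) * extForm α ζ z v := by
  rw [← hF.maurerCartan ζ hζ z v, ← mul_assoc,
    Matrix.mul_nonsing_inv _ (isUnit_det_of_det_eq_one (hF.det_eq_one z hζ)), one_mul]

lemma IsAdaptedKillingField.smoothMat (hξ : IsAdaptedKillingField α d ξ) {ζ : ℂ} (hζ : ζ ≠ 0) :
    SmoothMat (fun z => ξ z (ζ : OnePoint ℂ)) := by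
  obtain ⟨c, hc, hsum, -, -⟩ := hξ.adapted
  rw [smoothMat_iff]
  simp only [hsum ζ hζ]
  exact ContDiff.sum fun j _ => (smoothMat_iff.1 (hc j)).const_smul (ζ ^ j)

lemma IsExtendedFrame.hasDerivAt_ray (hF : IsExtendedFrame μ F α) {ζ : ℂ} (hζ : ζ ≠ 0) (z : ℂ)
    (t : ℝ) : HasDerivAt (fun s : ℝ => F (s * z) (ζ : OnePoint ℂ))
      (F (t * z) (ζ : OnePoint ℂ) * extForm α ζ (t * z) z) t := by
  rw [← hF.dMat_eq hζ]
  exact HSL.hasDerivAt_ray (hF.smoothMat hζ) z t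

lemma IsExtendedFrame.hasDerivAt_ray_inv (hF : IsExtendedFrame μ F α) {ζ : ℂ} (hζ : ζ ≠ 0) (z : ℂ)
    (t : ℝ) : HasDerivAt (fun s : ℝ => (F (s * z) (ζ : OnePoint ℂ))⁻¹)
      (-(extForm α ζ (t * z) z * (F (t * z) (ζ : OnePoint ℂ))⁻¹)) t :=
  hasDerivAt_mat_inv (hF.hasDerivAt_ray hζ z t) (hF.det_eq_one _ hζ)

lemma IsAdaptedKillingField.hasDerivAt_ray (hξ : IsAdaptedKillingField α d ξ) {ζ : ℂ} (hζ : ζ ≠ 0)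
    (z : ℂ) (t : ℝ) : HasDerivAt (fun s : ℝ => ξ (s * z) (ζ : OnePoint ℂ))
      (ξ (t * z) (ζ : OnePoint ℂ) * extForm α ζ (t * z) z -
        extForm α ζ (t * z) z * ξ (t * z) (ζ : OnePoint ℂ)) t := by
  rw [← hξ.lax ζ hζ]
  exact HSL.hasDerivAt_ray (hξ.smoothMat hζ) z t

/-- A Killing field is conjugated to its initial value by the frame. -/
lemma killing_conj (hF : IsExtendedFrame μ F α) (hξ : IsAdaptedKillingField α d ξ) {ζ : ℂ}
    (hζ : ζ ≠ 0) (z : ℂ) (t : ℝ) :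
    (F (t * z) (ζ : OnePoint ℂ))⁻¹ * F 0 (ζ : OnePoint ℂ) * ξ 0 (ζ : OnePoint ℂ) =
      ξ (t * z) (ζ : OnePoint ℂ) * (F (t * z) (ζ : OnePoint ℂ))⁻¹ * F 0 (ζ : OnePoint ℂ) := by
  -- The Lax equation is precisely the vanishing of the derivative of F ξ F⁻¹.
  have hd : ∀ t : ℝ, HasDerivAt (fun s : ℝ => F (s * z) (ζ : OnePoint ℂ) *
      ξ (s * z) (ζ : OnePoint ℂ) * (F (s * z) (ζ : OnePoint ℂ))⁻¹) 0 t := by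
    intro t
    refine (((hF.hasDerivAt_ray hζ z t).fun_mul (hξ.hasDerivAt_ray hζ z t)).fun_mul
      (hF.hasDerivAt_ray_inv hζ z t)).congr_deriv ?_
    noncomm_ring
  have hc := is_const_of_deriv_eq_zero (fun t => (hd t).differentiableAt) (fun t => (hd t).deriv) t 0
  simp only [ofReal_zero, zero_mul] at hc
  have ut := isUnit_det_of_det_eq_one (hF.det_eq_one (t * z) hζ)
  have u0 := isUnit_det_of_det_eq_one (hF.det_eq_one 0 hζ)
  set A := F (t * z) (ζ : OnePoint ℂ)
  set A0 := F 0 (ζ : OnePoint ℂ)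
  calc A⁻¹ * A0 * ξ 0 ζ = A⁻¹ * (A0 * ξ 0 ζ * A0⁻¹) * A0 := by
        simp only [mul_assoc]; rw [Matrix.nonsing_inv_mul _ u0, mul_one]
    _ = A⁻¹ * A * ξ (t * z) ζ * A⁻¹ * A0 := by rw [← hc]; simp only [mul_assoc]
    _ = _ := by rw [Matrix.nonsing_inv_mul _ ut, one_mul]

/-- The second factor of the exponential of the Symes datum, on the inner circle, before
normalisation at `ζ = 0`. -/
def innerFactor (F : ℂ → Loop) (d : ℕ) (ξ : ℂ → Loop) (z ζ : ℂ) : M3 :=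
  (F z (ζ : OnePoint ℂ))⁻¹ * F 0 (ζ : OnePoint ℂ) *
    NormedSpace.exp (z • ζ ^ (4 * d) • ξ 0 (ζ : OnePoint ℂ))

/-- Differentiating the exponential produces ξ(0) in the middle of the product; `killing_conj`
carries it to the left and turns it into ξ(tz), next to the −α_ζ coming from F⁻¹. -/
lemma hasDerivAt_innerFactor (hF : IsExtendedFrame μ F α) (hξ : IsAdaptedKillingField α d ξ) {ζ : ℂ}
    (hζ : ζ ≠ 0) (z : ℂ) (t : ℝ) :
    HasDerivAt (fun s : ℝ => innerFactor F d ξ (s * z) ζ)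
      ((z • ζ ^ (4 * d) • ξ (t * z) (ζ : OnePoint ℂ) - extForm α ζ (t * z) z) *
        innerFactor F d ξ (t * z) ζ) t := by
  have hk := killing_conj hF hξ hζ z t
  set X : M3 := z • ζ ^ (4 * d) • ξ 0 (ζ : OnePoint ℂ) with hX
  have hsm : ∀ s : ℝ, ((s : ℂ) * z) • ζ ^ (4 * d) • ξ 0 (ζ : OnePoint ℂ) = s • X := by
    intro s; rw [mul_smul, ← hX, Complex.coe_smul]
  have he : HasDerivAt (fun s : ℝ => NormedSpace.exp (s • X)) (X * NormedSpace.exp (t • X)) t :=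
    hasDerivAt_exp_smul_const' X t
  have h := ((hF.hasDerivAt_ray_inv hζ z t).mul_const (F 0 (ζ : OnePoint ℂ))).fun_mul he
  simp only [innerFactor, hsm]
  refine h.congr_deriv ?_
  have hk' : (F (t * z) (ζ : OnePoint ℂ))⁻¹ * F 0 (ζ : OnePoint ℂ) * X =
      z • ζ ^ (4 * d) • ξ (t * z) (ζ : OnePoint ℂ) * (F (t * z) (ζ : OnePoint ℂ))⁻¹ *
        F 0 (ζ : OnePoint ℂ) := by
    rw [hX, Matrix.mul_smul, Matrix.mul_smul, hk]
    simp only [Matrix.smul_mul]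
  change _ * NormedSpace.exp (t • X) + _ * (X * NormedSpace.exp (t • X)) = _
  rw [← mul_assoc _ X, hk']
  noncomm_ring

/-- Type (1,0) means complex linear, so the form is determined by its value on ∂/∂z. This lets α₋₂
and α₋₁ evaluated on z be compared with z times a coefficient of ξ. -/
lemma IsType10.apply {β : OneForm} (hβ : IsType10 β) (w v : ℂ) : β w v = v • ddz β w := by
  have h1 : β w v = (v.re : ℂ) • β w 1 + (v.im : ℂ) • β w I := by
    have : v = v.re • (1 : ℂ) + v.im • I := by
      simp only [Complex.real_smul, mul_one]; exact (Complex.re_add_im v).symm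
    conv_lhs => rw [this]
    rw [map_add, map_smul, map_smul, Complex.coe_smul, Complex.coe_smul]
  have h2 : β w I = I • β w 1 := by simpa using hβ w 1
  rw [h1, ddz, h2, smul_smul, smul_smul, smul_smul]
  rw [I_mul_I]
  conv_rhs => rw [← Complex.re_add_im v]
  module

/-- The logarithmic derivative of the inner factor has no pole at `ζ = 0`. -/
lemma exists_bound_innerFactor_ode (hF : IsExtendedFrame μ F α) (hξ : IsAdaptedKillingField α d ξ)
    (z : ℂ) : ∃ K : ℝ, ∀ t ∈ Set.Icc (0 : ℝ) 1, ∀ ζ : ℂ, ζ ≠ 0 → ‖ζ‖ ≤ 1 →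
      ‖z • ζ ^ (4 * d) • ξ (t * z) (ζ : OnePoint ℂ) - extForm α ζ (t * z) z‖ ≤ K := by
  obtain ⟨c, hc, hsum, hc2, hc1⟩ := hξ.adapted
  set N : ℤ := 4 * (d : ℤ) with hN
  have hsplit : ∀ f : ℤ → M3, ∑ j ∈ Finset.Icc (-(N + 2)) (N + 2), f j =
      f (-N - 2) + (f (-N - 1) + ∑ j ∈ Finset.Icc (-N) (N + 2), f j) := by
    intro f
    have e1 : Finset.Icc (-(N + 2)) (N + 2) =
        insert (-N - 2) (insert (-N - 1) (Finset.Icc (-N) (N + 2))) := by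
      ext j; simp only [Finset.mem_Icc, Finset.mem_insert]; lia
    rw [e1, Finset.sum_insert (by simp only [Finset.mem_Icc, Finset.mem_insert]; lia),
      Finset.sum_insert (by simp only [Finset.mem_Icc]; lia)]
  have hext : ∀ ζ w v : ℂ, extForm α ζ w v = ζ ^ (-2 : ℤ) • α (-2) w v +
      (ζ ^ (-1 : ℤ) • α (-1) w v + ∑ j ∈ Finset.Icc (0 : ℤ) 2, ζ ^ j • α j w v) := by
    intro ζ w v
    have e1 : Finset.Icc (-2 : ℤ) 2 = insert (-2) (insert (-1) (Finset.Icc (0 : ℤ) 2)) := by decide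
    rw [extForm, e1, Finset.sum_insert (by decide), Finset.sum_insert (by decide)]
  -- After the shift by N = 4d the two lowest terms of ξ have exponents −2 and −1, and cancel α₋₂
  -- and α₋₁.
  have key : ∀ (t : ℝ) (ζ : ℂ), ζ ≠ 0 →
      z • ζ ^ (4 * d) • ξ (t * z) (ζ : OnePoint ℂ) - extForm α ζ (t * z) z =
        ∑ j ∈ Finset.Icc (-N) (N + 2), ζ ^ (j + N) • z • c j (t * z) -
          ∑ j ∈ Finset.Icc (0 : ℤ) 2, ζ ^ j • α j (t * z) z := by
    intro t ζ hζ
    have hterm : ∀ j : ℤ, z • ζ ^ (4 * d) • ζ ^ j • c j (t * z) =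
        ζ ^ (j + N) • z • c j (t * z) := by
      intro j
      have : ζ ^ (4 * d) = ζ ^ N := by rw [hN, ← zpow_natCast]; norm_num
      rw [this, smul_smul (ζ ^ N), ← zpow_add₀ hζ, smul_comm, add_comm]
    rw [hsum ζ hζ, hsplit, hext, smul_add, smul_add, smul_add, smul_add, hterm, hterm,
      Finset.smul_sum, Finset.smul_sum, hF.type_neg_two.apply, hF.type_neg_one.apply,
      hc2, hc1, Finset.sum_congr rfl fun j _ => hterm j]
    rw [show -N - 2 + N = -2 by ring, show -N - 1 + N = -1 by ring]
    abel
  -- Only nonnegative powers of ζ remain, each of modulus at most 1, so dropping them gives a bound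
  -- that is continuous in t and independent of ζ.
  set bd : ℝ → ℝ := fun t => ∑ j ∈ Finset.Icc (-N) (N + 2), ‖z • c j (t * z)‖ +
    ∑ j ∈ Finset.Icc (0 : ℤ) 2, ‖α j (t * z) z‖ with hbd
  have hline : Continuous fun t : ℝ => (t : ℂ) * z := by fun_prop
  have hcont : Continuous bd := by
    refine Continuous.add (continuous_finsetSum _ fun j _ => ?_)
      (continuous_finsetSum _ fun j hj => ?_)
    · exact (((smoothMat_iff.1 (hc j)).continuous.comp hline).const_smul z).norm
    · have hj' : j ∈ Finset.Icc (-2 : ℤ) 2 := by rw [Finset.mem_Icc] at *; lia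
      exact ((smoothMat_iff.1 (hF.smooth_form j hj' z)).continuous.comp hline).norm
  obtain ⟨K, hK⟩ := (isCompact_Icc (a := (0 : ℝ)) (b := 1)).bddAbove_image hcont.continuousOn
  refine ⟨K, fun t ht ζ hζ h1 => ?_⟩
  rw [key t ζ hζ]
  have hpow : ∀ (j : ℤ), 0 ≤ j → ∀ X : M3, ‖ζ ^ j • X‖ ≤ ‖X‖ := by
    intro j hj X
    refine (norm_smul_le _ _).trans ?_
    have : ‖ζ ^ j‖ ≤ 1 := by
      lift j to ℕ using hj
      rw [zpow_natCast, norm_pow]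
      exact pow_le_one₀ (norm_nonneg _) h1
    exact mul_le_of_le_one_left (norm_nonneg _) this
  refine le_trans ?_ (hK (Set.mem_image_of_mem bd ht))
  refine (norm_sub_le _ _).trans (add_le_add ?_ ?_)
  · refine (norm_sum_le _ _).trans (Finset.sum_le_sum fun j hj => hpow _ ?_ _)
    rw [Finset.mem_Icc] at hj; lia
  · refine (norm_sum_le _ _).trans (Finset.sum_le_sum fun j hj => hpow _ ?_ _)
    rw [Finset.mem_Icc] at hj; lia

lemma innerFactor_zero (hF : IsExtendedFrame μ F α) {ζ : ℂ} (hζ : ζ ≠ 0) :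
    innerFactor F d ξ 0 ζ = 1 := by
  rw [innerFactor, zero_smul, NormedSpace.exp_zero, mul_one,
    Matrix.nonsing_inv_mul _ (isUnit_det_of_det_eq_one (hF.det_eq_one 0 hζ))]

/-- Grönwall's inequality along the ray, starting from the identity at t = 0; the constant is
uniform in ζ because the bound on the coefficient is. -/
lemma exists_bound_innerFactor (hF : IsExtendedFrame μ F α) (hξ : IsAdaptedKillingField α d ξ)
    (z : ℂ) : ∃ C : ℝ, ∀ ζ : ℂ, ζ ≠ 0 → ‖ζ‖ ≤ 1 → ‖innerFactor F d ξ z ζ‖ ≤ C := by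
  obtain ⟨K, hK⟩ := exists_bound_innerFactor_ode hF hξ z
  refine ⟨gronwallBound ‖(1 : M3)‖ K 0 (1 - 0), fun ζ hζ h1 => ?_⟩
  have hder := hasDerivAt_innerFactor hF hξ hζ z
  have := norm_le_gronwallBound_of_norm_deriv_right_le (a := 0) (b := 1) (K := K) (ε := 0)
    (δ := ‖(1 : M3)‖) (f := fun s : ℝ => innerFactor F d ξ (s * z) ζ)
    (fun t _ => (hder t).continuousAt.continuousWithinAt) (fun t _ => (hder t).hasDerivWithinAt)
    (by simp only [ofReal_zero, zero_mul]; rw [innerFactor_zero hF hζ]) (fun t ht => by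
      rw [add_zero]
      exact (norm_mul_le _ _).trans (mul_le_mul_of_nonneg_right
        (hK t ⟨ht.1, ht.2.le⟩ ζ hζ h1) (norm_nonneg _))) 1 (by simp)
  simpa using this

end Frames

/-! ### The inner factor -/

lemma norm_entry_le (X : M3) (i j : Fin 3) : ‖X i j‖ ≤ ‖X‖ := by
  rw [Matrix.linfty_opNorm_def]
  have h1 : ‖X i j‖₊ ≤ ∑ j, ‖X i j‖₊ :=
    Finset.single_le_sum (f := fun j => ‖X i j‖₊) (fun _ _ => zero_le) (Finset.mem_univ j)
  have h2 : ∑ j, ‖X i j‖₊ ≤ Finset.univ.sup fun i => ∑ j, ‖X i j‖₊ :=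
    Finset.le_sup (f := fun i => ∑ j, ‖X i j‖₊) (Finset.mem_univ i)
  exact_mod_cast h1.trans h2

lemma entryAnalyticAt_iff {h : ℂ → M3} {z : ℂ} : EntryAnalyticAt h z ↔ AnalyticAt ℂ h z := by
  constructor
  · intro hh
    have h1 : AnalyticAt ℂ (fun w => fun i j => h w i j) z := by
      rw [analyticAt_pi_iff]; intro i; rw [analyticAt_pi_iff]; exact hh i
    exact ((LinearMap.toContinuousLinearMap
      (Matrix.ofLinearEquiv ℂ : (Fin 3 → Fin 3 → ℂ) ≃ₗ[ℂ] M3).toLinearMap).analyticAt _).comp h1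
  · intro hh i j
    exact ((LinearMap.toContinuousLinearMap (Matrix.entryLinearMap ℂ ℂ i j)).analyticAt _).comp hh

lemma EntryAnalyticAt.exp {h : ℂ → M3} {z : ℂ} (hh : EntryAnalyticAt h z) :
    EntryAnalyticAt (fun w => NormedSpace.exp (h w)) z := by
  rw [entryAnalyticAt_iff] at *
  exact (NormedSpace.exp_analytic (𝕂 := ℂ) (h z)).comp hh

lemma EntryAnalyticAt.transpose {h : ℂ → M3} {z : ℂ} (hh : EntryAnalyticAt h z) :
    EntryAnalyticAt (fun w => (h w)ᵀ) z :=
  fun i j => hh j i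

lemma EntryAnalyticAt.tauGrp {h : ℂ → M3} {z : ℂ} (hh : EntryAnalyticAt h z)
    (hd : (h z).det = 1) : EntryAnalyticAt (fun w => tauGrp (h w)) z :=
  ((entryAnalyticAt_const _ _).mul (hh.transpose.inv (by rw [det_transpose, hd]))).mul
    (entryAnalyticAt_const _ _)

lemma eq_of_eq_punctured {f g : ℂ → ℂ} (hf : AnalyticAt ℂ f 0) (hg : AnalyticAt ℂ g 0)
    (h : ∀ w, w ≠ 0 → ‖w‖ < 1 → f w = g w) : f 0 = g 0 := by
  refine tendsto_nhds_unique (hf.continuousAt.tendsto.mono_left nhdsWithin_le_nhds)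
    ((hg.continuousAt.tendsto.mono_left nhdsWithin_le_nhds : Filter.Tendsto g (𝓝[≠] 0) _).congr' ?_)
  filter_upwards [self_mem_nhdsWithin,
    mem_nhdsWithin_of_mem_nhds (eventually_norm_lt (w := 0) (r := 1) (by simp))] with w h0 h1
  exact (h w h0 h1).symm

section Frames

variable {μ : ℂ →ₗ[ℝ] ℝ} {F : ℂ → Loop} {α : ℤ → OneForm} {d : ℕ} {ξ : ℂ → Loop}

lemma innerFactor_analytic (hF : IsExtendedFrame μ F α) (hξ : IsAdaptedKillingField α d ξ) (z : ℂ)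
    {ζ : ℂ} (hζ : ζ ≠ 0) : EntryAnalyticAt (innerFactor F d ξ z) ζ := by
  have hp := coe_mem_punctured.2 hζ
  refine ((((hF.loop z).1.entryAnalyticAt hp).inv (hF.det_eq_one z hζ)).mul
    ((hF.loop 0).1.entryAnalyticAt hp)).mul (EntryAnalyticAt.exp ?_)
  exact EntryAnalyticAt.smul analyticAt_const (EntryAnalyticAt.smul (by fun_prop)
    ((hξ.loop 0).1.entryAnalyticAt hp))

lemma innerFactor_det (hF : IsExtendedFrame μ F α) (hξ : IsAdaptedKillingField α d ξ) (z : ℂ)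
    {ζ : ℂ} (hζ : ζ ≠ 0) : (innerFactor F d ξ z ζ).det = 1 := by
  rw [innerFactor, det_mul, det_mul, det_inv_eq_one (hF.det_eq_one z hζ), hF.det_eq_one 0 hζ,
    det_exp_eq_one, one_mul, one_mul]
  rw [trace_smul, trace_smul, ((hξ.loop 0).2 ζ (coe_mem_punctured.2 hζ)).1, smul_zero, smul_zero]

lemma tauGrp_innerFactor (hF : IsExtendedFrame μ F α) (hξ : IsAdaptedKillingField α d ξ) (z : ℂ)
    {ζ : ℂ} (hζ : ζ ≠ 0) : tauGrp (innerFactor F d ξ z ζ) = innerFactor F d ξ z (I * ζ) := by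
  have hp := coe_mem_punctured.2 hζ
  have hI : I ^ (4 * d) = 1 := by rw [pow_mul, I_pow_four, one_pow]
  rw [innerFactor, tauGrp_mul, tauGrp_mul, tauGrp_inv (hF.det_eq_one z hζ),
    ((hF.loop z).2 ζ hp).2.2, ((hF.loop 0).2 ζ hp).2.2, tauGrp_exp, tauAlg_smul, tauAlg_smul,
    ((hξ.loop 0).2 ζ hp).2.2, rotI_coe, innerFactor, mul_pow, hI, one_mul]

/-- The inner factor extends holomorphically to `ζ = 0`. -/
lemma exists_innerFactor_extension (hF : IsExtendedFrame μ F α)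
    (hξ : IsAdaptedKillingField α d ξ) (z : ℂ) :
    ∃ H : ℂ → M3, (∀ w : ℂ, ‖w‖ < 1 → EntryAnalyticAt H w) ∧
      (∀ w : ℂ, w ≠ 0 → H w = innerFactor F d ξ z w) ∧
      (∀ w : ℂ, ‖w‖ < 1 → (H w).det = 1) ∧ ∀ w : ℂ, ‖w‖ < 1 → tauGrp (H w) = H (I * w) := by
  obtain ⟨C, hC⟩ := exists_bound_innerFactor hF hξ z
  -- The value at 0 is the limit of the inner factor, which exists by Riemann's theorem thanks to
  -- the bound C.
  set H : ℂ → M3 := fun w => Matrix.of fun i j =>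
    Function.update (fun v => innerFactor F d ξ z v i j) 0
      (Filter.limUnder (𝓝[≠] 0) fun v => innerFactor F d ξ z v i j) w with hH
  have hne : ∀ w : ℂ, w ≠ 0 → H w = innerFactor F d ξ z w := by
    intro w hw; ext i j; simp [hH, Function.update_of_ne hw]
  have han : ∀ w : ℂ, ‖w‖ < 1 → EntryAnalyticAt H w := by
    intro w hw i j
    have hball : Metric.ball (0 : ℂ) 1 ∈ 𝓝 (0 : ℂ) := Metric.ball_mem_nhds _ one_pos
    have hd := Complex.differentiableOn_update_limUnder_of_bddAbove
      (f := fun v => innerFactor F d ξ z v i j) hball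
      (fun v hv => ((innerFactor_analytic hF hξ z hv.2) i j).differentiableAt.differentiableWithinAt)
      (by
        refine ⟨C, ?_⟩
        rintro _ ⟨v, hv, rfl⟩
        exact (norm_entry_le _ _ _).trans (hC v hv.2 (mem_ball_zero_iff.1 hv.1).le))
    exact hd.analyticAt (Metric.isOpen_ball.mem_nhds (by simpa using hw))
  have hdet : ∀ w : ℂ, ‖w‖ < 1 → (H w).det = 1 := by
    intro w hw
    by_cases h0 : w = 0
    · subst h0
      exact eq_of_eq_punctured (han 0 hw).det analyticAt_const
        fun v hv _ => by rw [hne v hv, innerFactor_det hF hξ z hv]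
    · rw [hne w h0, innerFactor_det hF hξ z h0]
  refine ⟨H, han, hne, hdet, fun w hw => ?_⟩
  by_cases h0 : w = 0
  · subst h0
    ext i j
    have h1 := (han 0 hw).tauGrp (hdet 0 hw)
    have h2 : EntryAnalyticAt (fun v => H (I * v)) 0 :=
      EntryAnalyticAt.comp (f := fun v => I * v) (by simpa using han 0 hw) (by fun_prop)
    refine eq_of_eq_punctured (h1 i j) (h2 i j) fun v hv _ => ?_
    simp only
    rw [hne v hv, hne _ (mul_ne_zero I_ne_zero hv), tauGrp_innerFactor hF hξ z hv]
  · rw [hne w h0, hne _ (mul_ne_zero I_ne_zero h0), tauGrp_innerFactor hF hξ z h0]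

/-- Joint smoothness in z and ζ is what differentiation under a circle integral needs. For ξ(0) it
comes from the Laurent expansion. -/
lemma innerFactor_contDiffOn (hF : IsExtendedFrame μ F α) (hξ : IsAdaptedKillingField α d ξ) :
    ContDiffOn ℝ smoothExp (fun p : ℂ × ℂ => innerFactor F d ξ p.1 p.2) {p | p.2 ≠ 0} := by
  obtain ⟨c, -, hsum, -, -⟩ := hξ.adapted
  have h1 := hF.contDiffOn
  have h2 : ContDiffOn ℝ smoothExp (fun p : ℂ × ℂ => F 0 (p.2 : OnePoint ℂ)) {p | p.2 ≠ 0} :=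
    h1.comp (g := fun p : ℂ × ℂ => F p.1 (p.2 : OnePoint ℂ)) (f := fun p : ℂ × ℂ => ((0 : ℂ), p.2))
      (contDiff_const.prodMk contDiff_snd).contDiffOn (fun _ hp => hp)
  have h3 : ContDiffOn ℝ smoothExp (fun p : ℂ × ℂ => ξ 0 (p.2 : OnePoint ℂ)) {p | p.2 ≠ 0} := by
    refine ContDiffOn.congr (f := fun p : ℂ × ℂ =>
      ∑ j ∈ Finset.Icc (-(4 * (d : ℤ) + 2)) (4 * (d : ℤ) + 2), p.2 ^ j • c j 0) ?_
      (fun (p : ℂ × ℂ) (hp : p.2 ≠ 0) => hsum p.2 hp 0)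
    refine ContDiffOn.sum fun j _ => ?_
    rw [contDiffOn_mat_iff]
    intro k l
    refine ContDiffOn.mul (fun (p : ℂ × ℂ) (hp : p.2 ≠ 0) => ?_) contDiffOn_const
    have : AnalyticAt ℂ (fun w : ℂ => w ^ j) p.2 := analyticAt_id.zpow hp
    exact ((this.contDiffAt (n := smoothExp)).restrict_scalars ℝ).comp_contDiffWithinAt p
      contDiffWithinAt_snd
  have h4 : ContDiffOn ℝ smoothExp
      (fun p : ℂ × ℂ => p.1 • p.2 ^ (4 * d) • ξ 0 (p.2 : OnePoint ℂ)) {p | p.2 ≠ 0} :=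
    contDiffOn_fst.smul ((contDiffOn_snd.pow _).smul h3)
  have hexp : ContDiff ℝ smoothExp (NormedSpace.exp : M3 → M3) := by
    have : AnalyticOnNhd ℝ (NormedSpace.exp : M3 → M3) Set.univ :=
      fun x _ => NormedSpace.exp_analytic x
    exact contDiffOn_univ.1 (this.contDiffOn uniqueDiffOn_univ)
  exact ((contDiffOn_mat_inv h1 fun (p : ℂ × ℂ) (hp : p.2 ≠ 0) => hF.det_eq_one p.1 hp).mul h2).mul (hexp.comp_contDiffOn h4)

/-- The value at `ζ = 0` of the inner factor depends smoothly on `z`. -/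
lemma smoothMat_innerFactor_extension (hF : IsExtendedFrame μ F α)
    (hξ : IsAdaptedKillingField α d ξ) {H : ℂ → ℂ → M3}
    (hH : ∀ z w : ℂ, ‖w‖ < 1 → EntryAnalyticAt (H z) w)
    (hne : ∀ z w : ℂ, w ≠ 0 → H z w = innerFactor F d ξ z w) :
    SmoothMat (fun z => H z 0) := by
  intro i j
  have hc : ∀ t, circleMap 0 (1 / 2) t ≠ 0 := fun t => circleMap_ne_center (by norm_num)
  have hG : ContDiff ℝ smoothExp
      (fun p : ℂ × ℝ => innerFactor F d ξ p.1 (circleMap 0 (1 / 2) p.2) i j) := by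
    rw [← contDiffOn_univ]
    exact (contDiffOn_mat_iff.1 (innerFactor_contDiffOn hF hξ) i j).comp
      (f := fun p : ℂ × ℝ => (p.1, circleMap 0 (1 / 2) p.2))
      (contDiff_fst.prodMk ((contDiff_circleMap 0 _).comp contDiff_snd)).contDiffOn
      (fun (p : ℂ × ℝ) _ => hc p.2)
  have hint := contDiff_parametric_integral hG Real.two_pi_pos.le
  -- The mean value property recovers the value at ζ = 0 from the circle of radius 1/2, which avoids
  -- the puncture and stays inside the unit disc.
  have heq : (fun z => H z 0 i j) = fun z => (2 * Real.pi)⁻¹ •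
      ∫ t in (0 : ℝ)..2 * Real.pi, innerFactor F d ξ z (circleMap 0 (1 / 2) t) i j := by
    funext z
    have hd : DiffContOnCl ℂ (fun w => H z w i j) (Metric.ball 0 |1 / 2|) := by
      refine DifferentiableOn.diffContOnCl fun w hw => ?_
      have hw' : ‖w‖ < 1 := by
        have := Metric.closure_ball_subset_closedBall hw
        simp only [Metric.mem_closedBall, dist_zero_right] at this
        refine this.trans_lt ?_
        rw [abs_of_pos] <;> norm_num
      exact (hH z w hw' i j).differentiableAt.differentiableWithinAt
    rw [← hd.circleAverage, Real.circleAverage]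
    congr 1
    refine intervalIntegral.integral_congr fun t _ => ?_
    simp only [hne z _ (hc t)]
  rw [heq]
  exact hint.const_smul _

lemma smoothMat_unitaryPart {g : ℂ → M3} (hg : SmoothMat g) (h : ∀ z, g z ∈ G0C) :
    SmoothMat (fun z => unitaryPart (g z)) := by
  have hn : ContDiff ℝ smoothExp fun z => colNormSq (g z) := by
    have h1 : ∀ i j, ContDiff ℝ smoothExp fun z => Complex.normSq (g z i j) := by
      intro i j
      simp only [Complex.normSq_eq_norm_sq]
      exact (hg i j).norm_sq ℝ
    exact (h1 0 0).add (h1 1 0)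
  have hr : ContDiff ℝ smoothExp fun z => (((√(colNormSq (g z)))⁻¹ : ℝ) : ℂ) :=
    Complex.ofRealCLM.contDiff.comp ((hn.sqrt fun z => (colNormSq_pos (h z)).ne').inv
      fun z => (Real.sqrt_pos.2 (colNormSq_pos (h z))).ne')
  have hcj : ∀ i j, ContDiff ℝ smoothExp fun z => conj (g z i j) := fun i j =>
    Complex.conjCLE.contDiff.comp (hg i j)
  intro i j
  fin_cases i <;> fin_cases j <;> simp only [unitaryPart] <;>
    first
    | exact contDiff_const
    | exact hr.mul (hg 0 0)
    | exact hr.mul (hg 1 0)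
    | exact hr.mul (hcj 0 0)
    | exact (hr.mul (hcj 1 0)).neg

/-- `exp(zη)` is the product of a frame gauge equivalent to the given one, normalised at `z = 0`,
and of a loop in `Λ^τ_B(I_ε, G)`. -/
lemma exists_gauge_isEFactor {ε : ℝ} (hε0 : 0 < ε) (hε1 : ε < 1) (hF : IsExtendedFrame μ F α)
    (hξ : IsAdaptedKillingField α d ξ) :
    ∃ k : ℂ → M3, SmoothMat k ∧ (∀ z, k z ∈ G0) ∧ ∀ z : ℂ,
      (fun ζ => (F 0 ζ)⁻¹ * F z ζ * k z) ∈ loopGroup punctured ∧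
      IsEFactor ε (expLoop (symesDatum d ξ) z) (fun ζ => (F 0 ζ)⁻¹ * F z ζ * k z) := by
  choose H hHa hHne hHd hHτ using exists_innerFactor_extension hF hξ
  have h0 : ‖(0 : ℂ)‖ < 1 := by simp
  -- Rotation by i fixes ζ = 0, so the twist condition there says that the value is fixed by τ.
  have hmem : ∀ z, H z 0 ∈ G0C := fun z => ⟨hHd z 0 h0, by rw [hHτ z 0 h0, mul_zero]⟩
  have hkmem : ∀ z, unitaryPart (H z 0) ∈ G0 := fun z => unitaryPart_mem (hmem z)
  refine ⟨fun z => unitaryPart (H z 0), smoothMat_unitaryPart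
    (smoothMat_innerFactor_extension hF hξ hHa hHne) hmem, hkmem, fun z => ?_⟩
  have hL : (fun ζ => (F 0 ζ)⁻¹ * F z ζ * unitaryPart (H z 0)) ∈ loopGroup punctured :=
    loopGroup_mul (loopGroup_mul (loopGroup_inv (hF.loop 0)) (hF.loop z))
      (const_mem_loopGroup _ (hkmem z))
  refine ⟨hL, ?_⟩
  set k := unitaryPart (H z 0) with hk
  have hkG : k ∈ G0 := hkmem z
  have hki := G0C_inv hkG.1
  have uk := isUnit_det_of_det_eq_one hkG.1.1
  refine isEFactor_of_eq_on_inner (H := fun w => k⁻¹ * H z w) hε0 hε1 (fun ζ hζ => ?_) hL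
    (fun w hw => (entryAnalyticAt_const _ _).mul (hHa z w hw))
    (fun w hw => by rw [det_mul, hki.1, hHd z w hw, one_mul])
    (fun w hw => by rw [tauGrp_mul, hki.2, hHτ z w hw])
    (unitaryPart_inv_mul_mem (hmem z)) (fun ζ hζ => ?_)
  · have hζ0 : ζ ≠ 0 := norm_pos_iff.1 (by linarith)
    have hζ1 : ‖ζ‖ ≠ 1 := by linarith
    rw [expLoop, expLoop, conjGrp_exp, symesDatum, conjAlg_innerMul _ _ hζ0 hζ1
      (conjAlg_innerMul _ _ hζ0 hζ1 ((hξ.loop 0).2 ζ (coe_mem_punctured.2 hζ0)).2.1)]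
  · have hζ0 : ζ ≠ 0 := norm_pos_iff.1 (by linarith)
    have hζ1 : ‖ζ‖ < 1 := by linarith
    have u0 := isUnit_det_of_det_eq_one (hF.det_eq_one 0 hζ0)
    have uz := isUnit_det_of_det_eq_one (hF.det_eq_one z hζ0)
    rw [expLoop, innerMul_of_lt _ _ hζ1, symesDatum, innerMul_of_lt _ _ hζ1, hHne z ζ hζ0,
      innerFactor]
    generalize NormedSpace.exp (z • ζ ^ (4 * d) • ξ 0 (ζ : OnePoint ℂ)) = X
    calc X = (F 0 ζ)⁻¹ * (F 0 ζ * X) := by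
          rw [← mul_assoc, Matrix.nonsing_inv_mul _ u0, one_mul]
      _ = (F 0 ζ)⁻¹ * (F z ζ * (F z ζ)⁻¹) * (F 0 ζ * X) := by
          rw [Matrix.mul_nonsing_inv _ uz, mul_one]
      _ = (F 0 ζ)⁻¹ * F z ζ * (k * k⁻¹) * (F z ζ)⁻¹ * F 0 ζ * X := by
          rw [Matrix.mul_nonsing_inv _ uk, mul_one]; simp only [mul_assoc]
      _ = _ := by simp only [mul_assoc, ← hk]

end Frames

/-! ### The Symes map -/

lemma dMat_eq_fderiv {f : ℂ → M3} (hf : SmoothMat f) (z v : ℂ) : dMat f z v = fderiv ℝ f z v := by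
  have h := ((smoothMat_iff.1 hf).differentiable (by simp) z).hasFDerivAt
  ext i j
  have h2 := ((LinearMap.toContinuousLinearMap (Matrix.entryLinearMap ℝ ℂ i j)).hasFDerivAt
    (x := f z)).comp z h
  exact congrArg (fun L => L v) h2.fderiv

lemma dMat_mul {f g : ℂ → M3} (hf : SmoothMat f) (hg : SmoothMat g) (z v : ℂ) :
    dMat (fun w => f w * g w) z v = dMat f z v * g z + f z * dMat g z v := by
  have hfd := ((smoothMat_iff.1 hf).differentiable (by simp) z).hasFDerivAt
  have hgd := ((smoothMat_iff.1 hg).differentiable (by simp) z).hasFDerivAt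
  have hfg : SmoothMat fun w => f w * g w :=
    smoothMat_iff.2 ((smoothMat_iff.1 hf).mul (smoothMat_iff.1 hg))
  rw [dMat_eq_fderiv hf, dMat_eq_fderiv hg, dMat_eq_fderiv hfg]
  refine (congrArg (fun L => L v) (hfd.mul' hgd).fderiv).trans ?_
  change f z * _ + _ * g z = _
  rw [add_comm]
  rfl

lemma smoothMat_const (m : M3) : SmoothMat fun _ => m := fun _ _ => contDiff_const

lemma dMat_const (m : M3) (z v : ℂ) : dMat (fun _ => m) z v = 0 := by
  ext i j; simp [dMat]

lemma dMat_conjTranspose {f : ℂ → M3} (hf : SmoothMat f) (z v : ℂ) :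
    dMat (fun w => (f w)ᴴ) z v = (dMat f z v)ᴴ := by
  ext i j
  have h := ((hf j i).differentiable (by simp) z).hasFDerivAt
  have h2 := (Complex.conjCLE.toContinuousLinearMap.hasFDerivAt (x := f z j i)).comp z h
  exact congrArg (fun L => L v) h2.fderiv

lemma SmoothMat.conjTranspose {f : ℂ → M3} (hf : SmoothMat f) : SmoothMat fun w => (f w)ᴴ :=
  fun i j => Complex.conjCLE.contDiff.comp (hf j i)

lemma SmoothMat.mul {f g : ℂ → M3} (hf : SmoothMat f) (hg : SmoothMat g) :
    SmoothMat fun w => f w * g w :=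
  smoothMat_iff.2 ((smoothMat_iff.1 hf).mul (smoothMat_iff.1 hg))

lemma SmoothMat.dMat {f : ℂ → M3} (hf : SmoothMat f) (v : ℂ) : SmoothMat fun z => dMat f z v := by
  intro i j
  exact ((hf i j).fderiv_right (m := smoothExp) (by simp)).clm_apply contDiff_const

/-- The logarithmic derivative `k⁻¹dk` of a map into the unitary matrices. -/
def logDerivForm (k : ℂ → M3) : OneForm := fun z =>
  { toFun := fun v => (k z)ᴴ * dMat k z v
    map_add' := fun v w => by
      rw [← mul_add]; congr 1; ext i j; simp [dMat]
    map_smul' := fun r v => by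
      rw [RingHom.id_apply, ← Matrix.mul_smul]; congr 1; ext i j; exact map_smul (fderiv ℝ (fun w => k w i j) z) r v }

lemma logDerivForm_apply (k : ℂ → M3) (z v : ℂ) : logDerivForm k z v = (k z)ᴴ * dMat k z v := rfl

/-- Differentiate kᴴ k = 1. -/
lemma conjAlg_logDerivForm {k : ℂ → M3} (hk : SmoothMat k) (hG : ∀ z, k z ∈ G0) (z v : ℂ) :
    conjAlg (logDerivForm k z v) = logDerivForm k z v := by
  have h1 := dMat_mul hk.conjTranspose hk z v
  simp only [(hG _).2, dMat_const, dMat_conjTranspose hk] at h1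
  rw [logDerivForm_apply, conjAlg, conjTranspose_mul, conjTranspose_conjTranspose,
    eq_neg_of_add_eq_zero_left h1.symm, neg_neg]

/-- Pointwise conjugation of a one-form. -/
def conjForm (k : ℂ → M3) (β : OneForm) : OneForm := fun z =>
  { toFun := fun v => (k z)ᴴ * β z v * k z
    map_add' := fun v w => by rw [map_add, mul_add, add_mul]
    map_smul' := fun r v => by
      rw [map_smul, RingHom.id_apply, Matrix.mul_smul, Matrix.smul_mul] }

lemma conjForm_apply (k : ℂ → M3) (β : OneForm) (z v : ℂ) :
    conjForm k β z v = (k z)ᴴ * β z v * k z := rfl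

/-- The coefficients of the Maurer-Cartan form after a gauge transformation. -/
def gaugeForm (k : ℂ → M3) (α : ℤ → OneForm) (j : ℤ) : OneForm :=
  if j = 0 then fun z => conjForm k (α 0) z + logDerivForm k z else conjForm k (α j)

lemma gaugeForm_zero (k : ℂ → M3) (α : ℤ → OneForm) (z v : ℂ) :
    gaugeForm k α 0 z v = (k z)ᴴ * α 0 z v * k z + (k z)ᴴ * dMat k z v := rfl

lemma gaugeForm_of_ne (k : ℂ → M3) (α : ℤ → OneForm) {j : ℤ} (h : j ≠ 0) :
    gaugeForm k α j = conjForm k (α j) := if_neg h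

/-- The gauge does not depend on ζ, so its logarithmic derivative enters the ζ⁰ term only and the
other coefficients are merely conjugated. -/
lemma extForm_gaugeForm (k : ℂ → M3) (α : ℤ → OneForm) (ζ z v : ℂ) :
    extForm (gaugeForm k α) ζ z v =
      (k z)ᴴ * extForm α ζ z v * k z + (k z)ᴴ * dMat k z v := by
  have h0 : (0 : ℤ) ∈ Finset.Icc (-2 : ℤ) 2 := by decide
  rw [extForm, extForm, ← Finset.add_sum_erase _ _ h0, ← Finset.add_sum_erase _ _ h0,
    gaugeForm_zero, mul_add, add_mul, Finset.mul_sum, Finset.sum_mul, zpow_zero, one_smul, one_smul]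
  rw [Finset.sum_congr rfl (g := fun j => (k z)ᴴ * ζ ^ j • α j z v * k z) fun j hj => by
    rw [gaugeForm_of_ne _ _ (Finset.ne_of_mem_erase hj), conjForm_apply, Matrix.mul_smul,
      Matrix.smul_mul]]
  abel

lemma conjAlg_conj {k : M3} (X : M3) : conjAlg (kᴴ * X * k) = kᴴ * conjAlg X * k := by
  simp [conjAlg, mul_assoc]

section Frames

variable {μ : ℂ →ₗ[ℝ] ℝ} {F : ℂ → Loop} {α : ℤ → OneForm}

/-- Normalising the initial value and applying a gauge transformation does not leave the space of
extended frames. -/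
lemma IsExtendedFrame.gauge (hF : IsExtendedFrame μ F α) {k : ℂ → M3} (hk : SmoothMat k)
    (hG : ∀ z, k z ∈ G0) {Φ : ℂ → Loop} (hΦ : ∀ z, Φ z ∈ loopGroup punctured)
    (h : ∀ z, Set.EqOn (Φ z) (fun ζ => (F 0 ζ)⁻¹ * F z ζ * k z) punctured) :
    IsExtendedFrame μ Φ (gaugeForm k α) where
  loop := hΦ
  smooth := by
    -- Since the initial value does not depend on ζ, its inverse is a constant left factor and does
    -- not affect joint smoothness.
    obtain ⟨k0, hk0, hb⟩ := hF.based
    rw [← contDiffOn_mat_iff (f := fun p : ℂ × ℂ => Φ p.1 (p.2 : OnePoint ℂ))]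
    refine ContDiffOn.congr (f := fun p : ℂ × ℂ => k0⁻¹ * F p.1 (p.2 : OnePoint ℂ) * k p.1) ?_
      fun p hp => ?_
    · exact (contDiffOn_const.mul hF.contDiffOn).mul
        ((smoothMat_iff.1 hk).comp contDiff_fst).contDiffOn
    · rw [h _ (coe_mem_punctured.2 hp)]
      simp only [hb _ (coe_mem_punctured.2 hp)]
  based := by
    refine ⟨k 0, hG 0, fun ζ hζ => ?_⟩
    rw [h 0 hζ]
    simp only
    rw [Matrix.nonsing_inv_mul _ (isUnit_det_of_det_eq_one ((hF.loop 0).2 ζ hζ).1), one_mul]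
  smooth_form := by
    intro j hj v
    have h1 : SmoothMat fun z => conjForm k (α j) z v :=
      (hk.conjTranspose.mul (hF.smooth_form j hj v)).mul hk
    by_cases h0 : j = 0
    · subst h0
      exact smoothMat_iff.2 ((smoothMat_iff.1 h1).add
        (smoothMat_iff.1 (hk.conjTranspose.mul (hk.dMat v))))
    · rw [gaugeForm_of_ne _ _ h0]; exact h1
  maurerCartan := by
    intro ζ hζ z v
    have hp := coe_mem_punctured.2 hζ
    have hfun : (fun w => Φ w (ζ : OnePoint ℂ)) = fun w => (F 0 ζ)⁻¹ * F w ζ * k w :=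
      funext fun w => h w hp
    have hs : SmoothMat fun w => (F 0 (ζ : OnePoint ℂ))⁻¹ * F w ζ :=
      (smoothMat_const _).mul (hF.smoothMat hζ)
    have u0 := isUnit_det_of_det_eq_one (hF.det_eq_one 0 hζ)
    have uz := isUnit_det_of_det_eq_one (hF.det_eq_one z hζ)
    rw [hfun, h z hp, dMat_mul hs hk, dMat_mul (smoothMat_const _) (hF.smoothMat hζ),
      dMat_const, hF.dMat_eq hζ, extForm_gaugeForm, zero_mul, zero_add]
    simp only [Matrix.mul_inv_rev, Matrix.nonsing_inv_nonsing_inv _ u0, G0_inv_eq (hG z)]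
    set A := F z (ζ : OnePoint ℂ)
    set A0 := F 0 (ζ : OnePoint ℂ)
    calc (k z)ᴴ * (A⁻¹ * A0) * (A0⁻¹ * (A * extForm α ζ z v) * k z + A0⁻¹ * A * dMat k z v)
        = (k z)ᴴ * (A⁻¹ * (A0 * A0⁻¹) * A) * extForm α ζ z v * k z +
          (k z)ᴴ * (A⁻¹ * (A0 * A0⁻¹) * A) * dMat k z v := by noncomm_ring
      _ = _ := by
        rw [Matrix.mul_nonsing_inv _ u0, mul_one, Matrix.nonsing_inv_mul _ uz, mul_one]
  real := by
    intro j hj z v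
    by_cases h0 : j = 0
    · subst h0
      have h1 := hF.real 0 (by decide) z v
      rw [neg_zero] at h1 ⊢
      change conjAlg (conjForm k (α 0) z v + logDerivForm k z v) =
        conjForm k (α 0) z v + logDerivForm k z v
      have h2 : ∀ X Y : M3, conjAlg (X + Y) = conjAlg X + conjAlg Y := by
        intro X Y; simp [conjAlg, add_comm]
      rw [h2, conjAlg_logDerivForm hk hG, conjForm_apply, conjAlg_conj, h1]
    · rw [gaugeForm_of_ne _ _ h0, gaugeForm_of_ne _ _ (neg_ne_zero.2 h0), conjForm_apply,
        conjForm_apply, conjAlg_conj, hF.real j hj]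
  type_neg_two := by
    intro z v
    rw [gaugeForm_of_ne _ _ (by decide), conjForm_apply, conjForm_apply, hF.type_neg_two,
      Matrix.mul_smul, Matrix.smul_mul]
  type_neg_one := by
    intro z v
    rw [gaugeForm_of_ne _ _ (by decide), conjForm_apply, conjForm_apply, hF.type_neg_one,
      Matrix.mul_smul, Matrix.smul_mul]
  maslov := by
    intro z v
    rw [gaugeForm_of_ne _ _ (by decide), gaugeForm_of_ne _ _ (by decide), conjForm_apply,
      conjForm_apply, ← add_mul, ← mul_add, hF.maslov, Matrix.mul_smul, Matrix.smul_mul,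
      mul_assoc (k z)ᴴ, ← commute_D (hG z).1, ← mul_assoc, (hG z).2, one_mul]

end Frames

lemma symesMap_spec {ε : ℝ} {η : Loop} {z : ℂ}
    (h : ∃ g ∈ loopGroup punctured, IsEFactor ε (expLoop η z) g) :
    symesMap ε η z ∈ loopGroup punctured ∧ IsEFactor ε (expLoop η z) (symesMap ε η z) := by
  rw [symesMap, dif_pos h]
  exact h.choose_spec

end HSL

end

theorem mainTheorem9 (ε : ℝ) (hε0 : 0 < ε) (hε1 : ε < 1)
    (μ : ℂ →ₗ[ℝ] ℝ) (F : ℂ → HSL.Loop) (α : ℤ → HSL.OneForm) (hF : HSL.IsExtendedFrame μ F α)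
    (d : ℕ) (ξ : ℂ → HSL.Loop) (hξ : HSL.IsAdaptedKillingField α d ξ) :
    -- the loop `η = ζ^{4d} ξ(0)` is in the domain of the Symes map
    HSL.symesDatum d ξ ∈ HSL.loopAlgebraM2 ε ∧
    -- `Φ(η)(z)` is the unique first factor of `exp(zη)`
    (∀ z : ℂ,
      HSL.IsEFactor ε (HSL.expLoop (HSL.symesDatum d ξ) z)
        (HSL.symesMap ε (HSL.symesDatum d ξ) z) ∧
      ∀ g : HSL.Loop, HSL.IsEFactor ε (HSL.expLoop (HSL.symesDatum d ξ) z) g →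
        Set.EqOn g (HSL.symesMap ε (HSL.symesDatum d ξ) z) (HSL.annulus ε)) ∧
    HSL.symesMap ε (HSL.symesDatum d ξ) ∈ HSL.extendedFrames μ ∧
    -- `[F] = [Φ(η)]` for frames with `F(0) = I`
    ((∀ ζ ∈ HSL.punctured, F 0 ζ = 1) →
      HSL.GaugeEquiv F (HSL.symesMap ε (HSL.symesDatum d ξ))) ∧
    -- `[F] = [F(0) Φ(η)]` for an arbitrary initial value `F(0)` in `G₀`
    HSL.GaugeEquiv F (fun z ζ => F 0 ζ * HSL.symesMap ε (HSL.symesDatum d ξ) z ζ) := by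
  obtain ⟨k, hk, hG, hfac⟩ := HSL.exists_gauge_isEFactor hε0 hε1 hF hξ
  have hspec := fun z => HSL.symesMap_spec ⟨_, (hfac z).1, (hfac z).2⟩
  -- Whichever loop the Symes map selects, uniqueness identifies it with the explicit factor on the
  -- annulus, and the identity theorem extends this to ℂ∖{0}.
  have heq : ∀ z, Set.EqOn (HSL.symesMap ε (HSL.symesDatum d ξ) z)
      (fun ζ => (F 0 ζ)⁻¹ * F z ζ * k z) HSL.punctured := fun z =>
    HSL.eqOn_punctured_of_eqOn_annulus hε0 hε1 (hspec z).1.1 (hfac z).1.1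
      (HSL.IsEFactor.eqOn hε0 hε1 (hspec z).2 (hfac z).2)
  -- Solving for F leaves F(0) on the left, where a gauge transformation cannot absorb it, and puts
  -- kᴴ = k⁻¹ on the right.
  have hgauge : ∀ z, ∀ ζ ∈ HSL.punctured,
      F z ζ = F 0 ζ * HSL.symesMap ε (HSL.symesDatum d ξ) z ζ * (k z).conjTranspose := by
    intro z ζ hζ
    have u0 := HSL.isUnit_det_of_det_eq_one ((hF.loop 0).2 ζ hζ).1
    rw [heq z hζ]
    simp only
    rw [mul_assoc (F 0 ζ), mul_assoc _ (k z), HSL.G0_mul_conjTranspose (hG z), mul_one, ← mul_assoc,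
      Matrix.mul_nonsing_inv _ u0, one_mul]
  refine ⟨?_, fun z => ⟨(hspec z).2, fun g hg => HSL.IsEFactor.eqOn hε0 hε1 hg (hspec z).2⟩,
    ⟨_, hF.gauge hk hG (fun z => (hspec z).1) heq⟩, fun h1 => ?_, ?_⟩
  · obtain ⟨c, -, hsum, -, -⟩ := hξ.adapted
    exact HSL.symesDatum_mem_loopAlgebraM2 hε0 hε1 (hξ.loop 0) (c := fun j => c j 0)
      fun ζ hζ => hsum ζ hζ 0
  · refine ⟨fun z => (k z).conjTranspose, hk.conjTranspose, fun z => HSL.G0_conjTranspose (hG z),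
      fun z ζ hζ => ?_⟩
    rw [hgauge z ζ hζ, h1 ζ hζ, one_mul]
  · exact ⟨fun z => (k z).conjTranspose, hk.conjTranspose, fun z => HSL.G0_conjTranspose (hG z),
      hgauge⟩
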